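/- Let $R$ be a commutative ring with unit. For a finite matroid $G$ let $\mathcal E(G)$ be the exterior algebra over $R$ on generators $e_i$ of degree one, one for each point $i$ of $G$, and let $\partial$ be the linear map $\partial(e_{i_1}\wedge\cdots\wedge e_{i_p})=\sum_{k=1}^p(-1)^{k-1}e_{i_1}\wedge\cdots\wedge\widehat{e_{i_k}}\wedge\cdots\wedge e_{i_p}$. The Orlik–Solomon algebra of $G$ is the graded algebra $\mathcal A(G)=\mathcal E(G)/\mathcal I$, where $\mathcal I$ is the ideal generated by the elements $\partial(e_{i_1}\wedge\cdots\wedge e_{i_p})$ for all dependent tuples $(i_1,\dots,i_p)$ of points; $a_i$ denotes the image of $e_i$. A pointed matroid $dG$ is a matroid $G$ with a base point $0$ in its ground set, and its affine Orlik–Solomon algebra $\mathcal A_d(dG)$ is the graded subalgebra of $\mathcal A(G)$ generated by the elements $a_i-a_0$, where $i$ runs over the points of $G$. Let $dG_0$ and $dG_1$ be pointed matroids with finite ground sets whose base points are not loops (for instance, simple matroids), and let $P_d(dG_0,dG_1)$ be their parallel connection, that is, the pointed matroid of largest rank that is a union of pointed submatroids isomorphic to $dG_0$ and $dG_1$ whose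 ground sets intersect only at the base point. Let $f_0$ and $f_1$ be the inclusions of the points of $G_0$ and $G_1$ in those of $P_d(dG_0,dG_1)$. **Theorem 3.8.** There is an isomorphism of graded $R$-algebras $$\Phi:\ \mathcal A_d(dG_0)\otimes\mathcal A_d(dG_1)\ \xrightarrow{\ \cong\ }\ \mathcal A_d\bigl(P_d(dG_0,dG_1)\bigr),$$ where $\otimes$ is the tensor product over $R$ of graded algebras, with multiplication $(x\otimes y)(x'\otimes y')=(-1)^{\deg y\,\deg x'}\,xx'\otimes yy'$ for homogeneous elements, and where $x\otimes y$ has degree $\deg x+\deg y$. It is the natural homomorphism induced by the inclusions: $\Phi\bigl((a_i-a_0)\otimes1\bigr)=a_{f_0(i)}-a_0$ for every point $i$ of $G_0$, and $\Phi\bigl(1\otimes(a_j-a_0)\bigr)=a_{f_1(j)}-a_0$ for every point $j$ of $G_1$. -/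

import Mathlib

open scoped TensorProduct DirectSum

noncomputable section

/-- A pointed matroid: a matroid with a specified base point in its ground set. -/
structure PointedMatroid (α : Type*) where
  /-- the underlying unpointed matroid -/
  matroid : Matroid α
  /-- the base point -/
  base : α
  base_mem : base ∈ matroid.E

namespace PointedMatroid

/-- The type of points (elements of the ground set). -/
abbrev Pt {α : Type*} (G : PointedMatroid α) : Type _ := ↥G.matroid.E

/-- The base point, as an element of the type of points. -/
def basePt {α : Type*} (G : PointedMatroid α) : G.Pt := ⟨G.base, G.base_mem⟩

/-- `f` identifies `G` with a pointed submatroid (restriction to a subset of the ground set that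
contains the base point) of `P`. -/
structure IsEmbedding {α γ : Type*} (G : PointedMatroid α) (P : PointedMatroid γ)
    (f : G.Pt → P.Pt) : Prop where
  injective : Function.Injective f
  map_base : f G.basePt = P.basePt
  indep_iff : ∀ I : Set G.Pt,
    P.matroid.Indep ((fun i : G.Pt => (f i : γ)) '' I) ↔
      G.matroid.Indep ((fun i : G.Pt => (i : α)) '' I)

/-- `P` is a union of two pointed submatroids, isomorphic to `G₀` and `G₁` by means of `f₀` and
`f₁`, whose ground sets intersect only at the base point. -/
structure IsUnion {α β γ : Type*} (G₀ : PointedMatroid α) (G₁ : PointedMatroid β)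
    (P : PointedMatroid γ) (f₀ : G₀.Pt → P.Pt) (f₁ : G₁.Pt → P.Pt) : Prop where
  left : G₀.IsEmbedding P f₀
  right : G₁.IsEmbedding P f₁
  union_eq : Set.range f₀ ∪ Set.range f₁ = Set.univ
  inter_eq : Set.range f₀ ∩ Set.range f₁ = {P.basePt}

/-- `P`, together with the inclusions `f₀` and `f₁`, is the parallel connection of the pointed
matroids `G₀` and `G₁`: it has the largest rank among all pointed matroids that are unions of
copies of `G₀` and `G₁` whose ground sets intersect only at the base point. (All such finite unions
have the same number of points, so each of them has a copy on the ground set of `P`; it is no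
restriction that the competitors `Q` live on the same type as `P`.) -/
structure IsParallelConnection {α β γ : Type*} (G₀ : PointedMatroid α) (G₁ : PointedMatroid β)
    (P : PointedMatroid γ) (f₀ : G₀.Pt → P.Pt) (f₁ : G₁.Pt → P.Pt) : Prop where
  isUnion : G₀.IsUnion G₁ P f₀ f₁
  eRank_le : ∀ (Q : PointedMatroid γ) (g₀ : G₀.Pt → Q.Pt) (g₁ : G₁.Pt → Q.Pt),
    G₀.IsUnion G₁ Q g₀ g₁ → Q.matroid.eRank ≤ P.matroid.eRank

end PointedMatroid

/-! ### The Orlik-Solomon algebra of a matroid -/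

namespace OrlikSolomon

variable (R : Type*) [CommRing R]

/-- The exterior algebra `ℰ` on one generator for each element of `X`. -/
abbrev Ext (X : Type*) : Type _ := ExteriorAlgebra R (X →₀ R)

/-- The generator `e i` of the exterior algebra. -/
def e {X : Type*} (i : X) : Ext R X := ExteriorAlgebra.ι R (Finsupp.single i 1)

/-- The product `e_S = e_{i₁} ∧ ⋯ ∧ e_{iₚ}` for a tuple `S = (i₁, …, iₚ)`. -/
def eProd {X : Type*} (S : List X) : Ext R X := (S.map (e R)).prod

/-- The linear map `∂`: contraction with the linear form that sends every `e i` to `1`. See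
`boundary_eProd` for its values on the products `e_S`. -/
def boundary (X : Type*) : Ext R X →ₗ[R] Ext R X :=
  CliffordAlgebra.contractLeft (Finsupp.linearCombination R (fun _ : X => (1 : R)))

variable {R}

theorem boundary_e_mul {X : Type*} (i : X) (x : Ext R X) :
    boundary R X (e R i * x) = x - e R i * boundary R X x := by
  simp [boundary, e, ExteriorAlgebra.ι, CliffordAlgebra.contractLeft_ι_mul]

/-- `∂(e_{i₁} ∧ ⋯ ∧ e_{iₚ}) = ∑ₖ (-1)ᵏ⁻¹ e_{i₁} ∧ ⋯ ∧ (omit e_{iₖ}) ∧ ⋯ ∧ e_{iₚ}`; here the index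
`k` starts from `0`. -/
theorem boundary_eProd {X : Type*} (S : List X) :
    boundary R X (eProd R S)
      = ∑ k : Fin S.length, (-1 : R) ^ (k : ℕ) • eProd R (S.eraseIdx (k : ℕ)) := by
  induction S with
  | nil => simp [eProd, boundary]
  | cons i S ih =>
    have h : eProd R (i :: S) = e R i * eProd R S := by simp [eProd]
    rw [h, boundary_e_mul, ih]
    simp only [List.length_cons]
    rw [Fin.sum_univ_succ]
    simp only [Fin.val_zero, pow_zero, one_smul, List.eraseIdx_cons_zero, Fin.val_succ,
      List.eraseIdx_cons_succ, Finset.mul_sum, sub_eq_add_neg, ← Finset.sum_neg_distrib]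
    congr 1
    refine Finset.sum_congr rfl fun k _ => ?_
    simp [eProd, pow_succ]

variable (R)

variable {α : Type*} (M : Matroid α)

/-- The tuple `S` of points is dependent. -/
def IsDependent (S : List ↥M.E) : Prop := M.Dep {x | ∃ i ∈ S, (i : α) = x}

/-- The relations `∂ e_S = 0` for `S` dependent. -/
inductive Rel : Ext R ↥M.E → Ext R ↥M.E → Prop
  | of (S : List ↥M.E) (hS : IsDependent M S) : Rel (boundary R ↥M.E (eProd R S)) 0

/-- The Orlik-Solomon algebra `𝒜(M)` with coefficients in `R`: the quotient of the exterior algebra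
on the points of `M` by the (two-sided) ideal generated by all `∂ e_S` with `S` dependent. -/
def OS : Type _ := RingQuot (Rel R M)

instance : Ring (OS R M) := inferInstanceAs (Ring (RingQuot (Rel R M)))

instance : Algebra R (OS R M) := inferInstanceAs (Algebra R (RingQuot (Rel R M)))

/-- The quotient map from the exterior algebra. -/
def mk : Ext R ↥M.E →ₐ[R] OS R M := RingQuot.mkAlgHom R (Rel R M)

/-- The generator `a i` of the Orlik-Solomon algebra. -/
def a (i : ↥M.E) : OS R M := mk R M (e R i)

/-- The component of degree `p` of the Orlik-Solomon algebra: the image of the `p`-th exterior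
power. -/
def grading (p : ℕ) : Submodule R (OS R M) :=
  (⋀[R]^p (↥M.E →₀ R)).map (mk R M).toLinearMap

variable {R M}

theorem mk_boundary {S : List ↥M.E} (hS : IsDependent M S) :
    mk R M (boundary R ↥M.E (eProd R S)) = 0 := by
  have := RingQuot.mkAlgHom_rel R (Rel.of (R := R) S hS)
  rw [map_zero] at this
  exact this

instance : SetLike.GradedMonoid (grading R M) where
  one_mem := ⟨1, SetLike.GradedOne.one_mem, map_one (mk R M)⟩
  mul_mem := by
    rintro i j _ _ ⟨x, hx, rfl⟩ ⟨y, hy, rfl⟩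
    exact ⟨x * y, SetLike.GradedMul.mul_mem hx hy, map_mul (mk R M) _ _⟩

theorem mk_mem_grading {p : ℕ} {x : Ext R ↥M.E} (hx : x ∈ ⋀[R]^p (↥M.E →₀ R)) :
    mk R M x ∈ grading R M p := ⟨x, hx, rfl⟩

theorem ι_mem {X : Type*} (m : X →₀ R) : ExteriorAlgebra.ι R m ∈ ⋀[R]^1 (X →₀ R) := by
  rw [ExteriorAlgebra.exteriorPower, pow_one]; exact ⟨_, rfl⟩

theorem e_mem {X : Type*} (i : X) : e R i ∈ ⋀[R]^1 (X →₀ R) := ι_mem _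

theorem eProd_mem {X : Type*} (S : List X) : eProd R S ∈ ⋀[R]^S.length (X →₀ R) := by
  induction S with
  | nil => exact SetLike.GradedOne.one_mem (A := fun p : ℕ => ⋀[R]^p (X →₀ R))
  | cons i S ih =>
    have h : eProd R (i :: S) = e R i * eProd R S := by simp [eProd]
    rw [h, List.length_cons, add_comm]
    exact SetLike.GradedMul.mul_mem (A := fun p : ℕ => ⋀[R]^p (X →₀ R)) (e_mem i) ih

theorem boundary_eProd_mem {X : Type*} (S : List X) :
    boundary R X (eProd R S) ∈ ⋀[R]^(S.length - 1) (X →₀ R) := by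
  rw [boundary_eProd]
  refine Submodule.sum_mem _ fun k _ => Submodule.smul_mem _ _ ?_
  have h := eProd_mem (R := R) (S.eraseIdx k)
  rwa [List.length_eraseIdx_of_lt k.2] at h

/-- The map that decomposes an element of the exterior algebra into the homogeneous components of
its image in the Orlik-Solomon algebra. -/
def decomposeExt (R : Type*) [CommRing R] (M : Matroid α) :
    Ext R ↥M.E →ₐ[R] ⨁ p, grading R M p :=
  ExteriorAlgebra.lift R
    ⟨DirectSum.lof R ℕ (fun p => grading R M p) 1 ∘ₗ
      ((mk R M).toLinearMap ∘ₗ ExteriorAlgebra.ι R).codRestrict _ fun m =>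
        mk_mem_grading (ι_mem m), fun m => by
      rw [LinearMap.comp_apply, DirectSum.lof_eq_of, DirectSum.of_mul_of]
      refine DFinsupp.single_eq_zero.mpr (Subtype.ext ?_)
      change mk R M (ExteriorAlgebra.ι R m) * mk R M (ExteriorAlgebra.ι R m) = 0
      rw [← map_mul, ExteriorAlgebra.ι_sq_zero, map_zero]⟩

theorem decomposeExt_of_mem {p : ℕ} {x : Ext R ↥M.E} (hx : x ∈ ⋀[R]^p (↥M.E →₀ R)) :
    decomposeExt R M x
      = DirectSum.of (fun p => grading R M p) p ⟨mk R M x, mk_mem_grading hx⟩ := by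
  induction hx using Submodule.pow_induction_on_left' with
  | algebraMap r =>
    rw [AlgHom.commutes, DirectSum.algebraMap_apply]
    congr 1
    exact Subtype.ext ((mk R M).commutes r).symm
  | add x y i hx hy ihx ihy =>
    rw [map_add, ihx, ihy, ← map_add]
    congr 1
    exact Subtype.ext (map_add (mk R M) x y).symm
  | mem_mul m hm i x hx ih =>
    obtain ⟨m, rfl⟩ := hm
    rw [map_mul, ih, decomposeExt, ExteriorAlgebra.lift_ι_apply, LinearMap.comp_apply,
      DirectSum.lof_eq_of, DirectSum.of_mul_of]
    exact DirectSum.of_eq_of_gradedMonoid_eq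
      (Sigma.subtype_ext (add_comm _ _) (map_mul (mk R M) _ _).symm)

/-- The decomposition of the Orlik-Solomon algebra into homogeneous components. -/
def decomposeOS (R : Type*) [CommRing R] (M : Matroid α) : OS R M →ₐ[R] ⨁ p, grading R M p :=
  RingQuot.liftAlgHom R ⟨decomposeExt R M, by
    rintro _ _ ⟨S, hS⟩
    rw [map_zero, decomposeExt_of_mem (boundary_eProd_mem S)]
    refine DFinsupp.single_eq_zero.mpr (Subtype.ext ?_)
    exact mk_boundary hS⟩

theorem decomposeOS_mk (x : Ext R ↥M.E) : decomposeOS R M (mk R M x) = decomposeExt R M x := by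
  unfold decomposeOS mk
  exact RingQuot.liftAlgHom_mkAlgHom_apply R _ _ x

/-- The Orlik-Solomon algebra is a graded algebra. -/
instance : GradedAlgebra (grading R M) :=
  GradedAlgebra.ofAlgHom _ (decomposeOS R M)
    (by
      refine RingQuot.ringQuot_ext' R _ _ (ExteriorAlgebra.hom_ext (LinearMap.ext fun m => ?_))
      change DirectSum.coeAlgHom (grading R M) (decomposeOS R M (mk R M (ExteriorAlgebra.ι R m)))
        = mk R M (ExteriorAlgebra.ι R m)
      rw [decomposeOS_mk, decomposeExt_of_mem (ι_mem m),
        DirectSum.coeAlgHom_of])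
    (by
      rintro p ⟨_, x, hx, rfl⟩
      change decomposeOS R M (mk R M x) = _
      rw [decomposeOS_mk, decomposeExt_of_mem hx]
      rfl)

end OrlikSolomon

/-! ### The (affine) Orlik-Solomon algebra of a pointed matroid -/

namespace PointedMatroid

open OrlikSolomon

variable (R : Type*) [CommRing R] {α : Type*} (G : PointedMatroid α)

/-- The Orlik-Solomon algebra of a pointed matroid with base point `0`: the subalgebra of the
Orlik-Solomon algebra of the underlying matroid that is generated by all `a i - a 0`. -/
def affineOS : Subalgebra R (OS R G.matroid) :=
  Algebra.adjoin R (Set.range fun i : G.Pt => a R G.matroid i - a R G.matroid G.basePt)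

/-- The generator `a i - a 0` of the affine Orlik-Solomon algebra. -/
def gen (i : G.Pt) : G.affineOS R :=
  ⟨a R G.matroid i - a R G.matroid G.basePt, Algebra.subset_adjoin ⟨i, rfl⟩⟩

/-- The grading that the affine Orlik-Solomon algebra inherits as a subalgebra. -/
def affineGrading (p : ℕ) : Submodule R (G.affineOS R) :=
  (grading R G.matroid p).comap (G.affineOS R).val.toLinearMap

variable {R G}

instance : SetLike.GradedMonoid (G.affineGrading R) where
  one_mem := SetLike.GradedOne.one_mem (A := grading R G.matroid)
  mul_mem := fun _ _ _ _ hx hy => SetLike.GradedMul.mul_mem (A := grading R G.matroid) hx hy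

theorem decompose_mem_affineOS {x : OS R G.matroid} (hx : x ∈ G.affineOS R) (p : ℕ) :
    (DirectSum.decompose (grading R G.matroid) x p : OS R G.matroid) ∈ G.affineOS R := by
  induction hx using Algebra.adjoin_induction generalizing p with
  | mem x hx =>
    obtain ⟨i, rfl⟩ := hx
    have h1 : a R G.matroid i - a R G.matroid G.basePt ∈ grading R G.matroid 1 :=
      Submodule.sub_mem _ (mk_mem_grading (e_mem i)) (mk_mem_grading (e_mem _))
    by_cases hp : 1 = p
    · subst hp
      rw [DirectSum.decompose_of_mem_same _ h1]
      exact Algebra.subset_adjoin ⟨i, rfl⟩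
    · rw [DirectSum.decompose_of_mem_ne _ h1 hp]
      exact zero_mem _
  | algebraMap r =>
    have h0 : algebraMap R (OS R G.matroid) r ∈ grading R G.matroid 0 :=
      SetLike.algebraMap_mem_graded _ r
    by_cases hp : 0 = p
    · subst hp
      rw [DirectSum.decompose_of_mem_same _ h0]
      exact Subalgebra.algebraMap_mem _ r
    · rw [DirectSum.decompose_of_mem_ne _ h0 hp]
      exact zero_mem _
  | add x y _ _ ihx ihy =>
    rw [DirectSum.decompose_add, DirectSum.add_apply, Submodule.coe_add]
    exact add_mem (ihx p) (ihy p)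
  | mul x y _ _ ihx ihy =>
    classical
    rw [DirectSum.decompose_mul, DirectSum.coe_mul_apply]
    exact sum_mem fun ij _ => mul_mem (ihx _) (ihy _)

theorem affineGrading_isInternal : DirectSum.IsInternal (G.affineGrading R) := by
  classical
  constructor
  · have hcomp : ∀ z : ⨁ p, G.affineGrading R p, ∀ q,
        ((DirectSum.decompose (grading R G.matroid)
          (DirectSum.coeAddMonoidHom (G.affineGrading R) z : OS R G.matroid) q : OS R G.matroid))
          = ((z q : G.affineOS R) : OS R G.matroid) := by
      intro z q
      induction z using DirectSum.induction_on with
      | zero => simp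
      | of p x =>
        rw [DirectSum.coeAddMonoidHom_of]
        have hx : ((x : G.affineOS R) : OS R G.matroid) ∈ grading R G.matroid p := x.2
        by_cases hp : p = q
        · subst hp
          rw [DirectSum.decompose_of_mem_same _ hx, DirectSum.of_eq_same]
        · rw [DirectSum.decompose_of_mem_ne _ hx hp, DirectSum.of_eq_of_ne _ _ _ (Ne.symm hp)]
          rfl
      | add x y hx hy => simp [DirectSum.decompose_add, hx, hy]
    intro x y hxy
    refine DFinsupp.ext fun q => Subtype.ext (Subtype.ext ?_)
    rw [← hcomp x q, ← hcomp y q, hxy]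
  · intro x
    refine ⟨∑ p ∈ (DirectSum.decompose (grading R G.matroid) (x : OS R G.matroid)).support,
      DirectSum.of (fun p => G.affineGrading R p) p
        ⟨⟨_, decompose_mem_affineOS x.2 p⟩,
          (DirectSum.decompose (grading R G.matroid) (x : OS R G.matroid) p).2⟩, ?_⟩
    rw [map_sum]
    simp only [DirectSum.coeAddMonoidHom_of]
    refine Subtype.ext ?_
    rw [AddSubmonoidClass.coe_finsetSum]
    exact DirectSum.sum_support_decompose (grading R G.matroid) (x : OS R G.matroid)

/-- The affine Orlik-Solomon algebra is a graded algebra. -/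
instance : GradedAlgebra (G.affineGrading R) where
  toDecomposition := affineGrading_isInternal.chooseDecomposition

end PointedMatroid

/-- The component of degree `n` of the (graded) tensor product of two graded algebras: the span of
all `x ⊗ y` with `x` and `y` homogeneous and `deg x + deg y = n`. -/
def tensorGrading {R A B : Type*} [CommRing R] [Ring A] [Ring B] [Algebra R A] [Algebra R B]
    (𝒜 : ℕ → Submodule R A) (ℬ : ℕ → Submodule R B) [GradedAlgebra 𝒜] [GradedAlgebra ℬ] (n : ℕ) :
    Submodule R (𝒜 ᵍ⊗[R] ℬ) :=
  Submodule.span R {t | ∃ p q : ℕ, p + q = n ∧ ∃ x ∈ 𝒜 p, ∃ y ∈ ℬ q, t = x ᵍ⊗ₜ[R] y}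

end

/-! The substitution e_i ↦ e_i - e_0 sends e_S to ∂(e_0 e_S) and fixes ∂e_S, so it descends to a map
of the Orlik–Solomon algebra onto the affine one (`retract`). Homomorphisms between affine algebras
can thus be built on whole Orlik–Solomon algebras, the base point going to 0. The map Φ comes from
the universal property of the graded tensor product, because the images of the two factors commute
up to the Koszul sign. Its inverse sends a_k to the generator of the factor that contains k. The
difficulty is to see that this assignment kills ∂e_S for every S that is dependent in P.

Maximality of the rank enters through `IsParallelConnection.dep`: for S dependent, either one of its
parts S₀, S₁ on the two sides is dependent, or both become dependent once the base point is added.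
In the first case ∂e_S is killed by a relation of one factor and the Leibniz rule. In the second,
with 0 not in S, the relation ∂(e_0 e_{S₀}) = e_{S₀} - e_0 ∂e_{S₀} and e_0 ↦ 0 show that e_{S₀} is
killed; so is e_{S₁}, and each Leibniz term of ∂(e_{S₀} e_{S₁}) keeps one of these factors
(`IsParallelConnection.kills`).

For the combinatorial fact, the sets in `ParallelIndep` form a matroid with the prescribed
restrictions (`ParallelIndep.augment`), so its rank is at most that of P. Each of them lies in some
(B₀ \ {p}) ∪ B₁ with Bᵢ bases of the sides (in one order or the other) and p ∈ B₀. This union is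
again in `ParallelIndep` and spans P; having at most rank-many elements, it is independent in P
(`ParallelIndep.indep`). -/

noncomputable section

/-! ### The parallel connection as a matroid -/

namespace Matroid

variable {γ : Type*}

/-- Augmentation for pairs of independent sets on two sides. -/
theorem exists_insert_pair {M : Matroid γ} [M.Finite] {A B A' B' : Set γ}
    (hA : M.Indep A) (hB : M.Indep B) (hA' : M.Indep A') (hB' : M.Indep B')
    (h : A.encard + B.encard < A'.encard + B'.encard) :
    (∃ x ∈ A' \ A, M.Indep (insert x A)) ∨ (∃ x ∈ B' \ B, M.Indep (insert x B)) := by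
  rcases lt_or_ge A.encard A'.encard with h1 | h1
  · obtain ⟨x, hx, hi⟩ := hA.exists_insert_of_encard_lt hA' h1
    exact .inl ⟨x, hx, hi⟩
  rcases lt_or_ge B.encard B'.encard with h2 | h2
  · obtain ⟨x, hx, hi⟩ := hB.exists_insert_of_encard_lt hB' h2
    exact .inr ⟨x, hx, hi⟩
  exact absurd h (not_lt.mpr (add_le_add h1 h2))

/-- If `C` is independent and its extension by `p` is not, then some element of `C` can be exchanged
for `p`, and the exchange can be undone after an augmentation. -/
theorem Indep.exists_exchange {M : Matroid γ} {C : Set γ} {p : γ} (hC : M.Indep C)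
    (hp : M.Indep {p}) (hpC : ¬ M.Indep (insert p C)) :
    ∃ x ∈ C, M.Indep (insert p (C \ {x})) ∧ p ∉ C ∧
      ∀ y ∉ insert p (C \ {x}), M.Indep (insert y (insert p (C \ {x}))) →
        y ∉ C ∧ M.Indep (insert y C) := by
  have hpcl : p ∈ M.closure C := by
    by_contra h
    exact hpC (hC.insert_indep_iff.mpr (.inl ⟨hp.subset_ground rfl, h⟩))
  have hpn : p ∉ C := fun h => hpC (by rwa [Set.insert_eq_of_mem h])
  have hcirc := hC.fundCircuit_isCircuit hpcl hpn
  -- The fundamental circuit is not contained in {p}, because p is not a loop.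
  have hex : ∃ x ∈ M.fundCircuit p C, x ≠ p := by
    by_contra! h
    have hsub : M.fundCircuit p C ⊆ {p} := fun x hx => h x hx
    exact hcirc.not_indep (hp.subset hsub)
  obtain ⟨x, hx, hxp⟩ := hex
  have hxC : x ∈ C := (M.fundCircuit_subset_insert p C hx).resolve_left hxp
  have hind : M.Indep (insert p (C \ {x})) := by
    rw [← Set.insert_sdiff_of_notMem _ (by simpa using hxp.symm)]
    exact (hC.mem_fundCircuit_iff hpcl hpn).mp hx
  refine ⟨x, hxC, hind, hpn, fun y hy hyi => ?_⟩
  have hycl : y ∉ M.closure (insert p (C \ {x})) := by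
    have := (hind.insert_indep_iff_of_notMem hy).mp hyi
    exact this.2
  have hyE : y ∈ M.E := hyi.subset_ground (Set.mem_insert _ _)
  -- The exchange loses nothing from the span: x lies in the closure of the rest of the circuit.
  -- Hence whatever augments the exchanged set also augments C.
  have hcl : M.closure C ⊆ M.closure (insert p (C \ {x})) := by
    refine M.closure_subset_closure_of_subset_closure fun z hz => ?_
    rcases eq_or_ne z x with rfl | hzx
    · have h1 := hcirc.mem_closure_sdiff_singleton_of_mem hx
      refine M.closure_subset_closure ?_ h1
      rintro w ⟨hw, hwx⟩
      rcases M.fundCircuit_subset_insert p C hw with rfl | hwC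
      · exact Set.mem_insert _ _
      · exact Set.mem_insert_of_mem _ ⟨hwC, hwx⟩
    · exact M.mem_closure_of_mem' (Set.mem_insert_of_mem _ ⟨hz, hzx⟩) (hC.subset_ground hz)
  have hyC : y ∉ M.closure C := fun h => hycl (hcl h)
  exact ⟨fun h => hyC (M.mem_closure_of_mem' h hyE), hC.insert_indep_iff.mpr (.inl ⟨hyE, hyC⟩)⟩

/-- The independent sets of the parallel connection of the restrictions of `M` to `E₀` and `E₁`,
whose intersection is `{p}`. -/
structure ParallelIndep (M : Matroid γ) (p : γ) (E₀ E₁ I : Set γ) : Prop where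
  subset : I ⊆ E₀ ∪ E₁
  left : M.Indep (I ∩ E₀)
  right : M.Indep (I ∩ E₁)
  insert_or : M.Indep (insert p (I ∩ E₀)) ∨ M.Indep (insert p (I ∩ E₁))

namespace ParallelIndep

variable {M : Matroid γ} {p : γ} {E₀ E₁ I J : Set γ}

theorem symm (h : ParallelIndep M p E₀ E₁ I) : ParallelIndep M p E₁ E₀ I :=
  ⟨h.subset.trans (Set.union_comm _ _).subset, h.right, h.left, h.insert_or.symm⟩

theorem mono (h : ParallelIndep M p E₀ E₁ J) (hIJ : I ⊆ J) : ParallelIndep M p E₀ E₁ I :=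
  ⟨hIJ.trans h.subset, h.left.subset (Set.inter_subset_inter_left _ hIJ),
    h.right.subset (Set.inter_subset_inter_left _ hIJ),
    h.insert_or.imp
      (fun h => h.subset (Set.insert_subset_insert (Set.inter_subset_inter_left _ hIJ)))
      (fun h => h.subset (Set.insert_subset_insert (Set.inter_subset_inter_left _ hIJ)))⟩

theorem encard_add (hE : E₀ ∩ E₁ = {p}) (hI : I ⊆ E₀ ∪ E₁) (hp : p ∉ I) :
    (I ∩ E₀).encard + (I ∩ E₁).encard = I.encard := by
  rw [← Set.encard_union_eq, ← Set.inter_union_distrib_left, Set.inter_eq_left.mpr hI]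
  rw [Set.disjoint_iff_inter_eq_empty, ← Set.inter_inter_distrib_left, hE]
  simpa using hp

theorem encard_add_of_mem (hE : E₀ ∩ E₁ = {p}) (hI : I ⊆ E₀ ∪ E₁) (hp : p ∈ I) :
    (I ∩ E₀).encard + (I ∩ E₁).encard = I.encard + 1 := by
  rw [← Set.encard_union_add_encard_inter, ← Set.inter_union_distrib_left,
    Set.inter_eq_left.mpr hI, ← Set.inter_inter_distrib_left, hE,
    Set.inter_eq_right.mpr (by simpa using hp), Set.encard_singleton]

theorem insert_left (hE : E₀ ∩ E₁ = {p}) {y : γ} (hy : y ∈ E₀) (hyp : y ≠ p)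
    (hI : I ⊆ E₀ ∪ E₁) (h₀ : M.Indep (insert y (I ∩ E₀))) (h₁ : M.Indep (insert p (I ∩ E₁))) :
    ParallelIndep M p E₀ E₁ (insert y I) := by
  have hy1 : y ∉ E₁ := fun h => hyp (by have : y ∈ E₀ ∩ E₁ := ⟨hy, h⟩; rwa [hE] at this)
  refine ⟨Set.insert_subset (.inl hy) hI, ?_, ?_, ?_⟩
  · rwa [Set.insert_inter_of_mem hy]
  · rw [Set.insert_inter_of_notMem hy1]; exact h₁.subset (Set.subset_insert _ _)
  · rw [Set.insert_inter_of_notMem hy1]; exact .inr h₁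

theorem insert_right (hE : E₀ ∩ E₁ = {p}) {y : γ} (hy : y ∈ E₁) (hyp : y ≠ p)
    (hI : I ⊆ E₀ ∪ E₁) (h₀ : M.Indep (I ∩ E₀)) (h₁ : M.Indep (insert y (insert p (I ∩ E₁)))) :
    ParallelIndep M p E₀ E₁ (insert y I) := by
  have hy0 : y ∉ E₀ := fun h => hyp (by have : y ∈ E₀ ∩ E₁ := ⟨h, hy⟩; rwa [hE] at this)
  refine ⟨Set.insert_subset (.inr hy) hI, ?_, ?_, ?_⟩
  · rwa [Set.insert_inter_of_notMem hy0]
  · rw [Set.insert_inter_of_mem hy]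
    exact h₁.subset (Set.insert_subset_insert (Set.subset_insert _ _))
  · rw [Set.insert_inter_of_mem hy, Set.insert_comm]; exact .inr h₁

/-- Counting p once per side gives one element more than J: either p ∈ J is counted twice, or p can
be added to one of the sides. -/
theorem exists_large_sides (hE : E₀ ∩ E₁ = {p})
    (hJ : ParallelIndep M p E₀ E₁ J) :
    ∃ U V, U ⊆ insert p (J ∩ E₀) ∧ V ⊆ insert p (J ∩ E₁) ∧ M.Indep U ∧ M.Indep V ∧
      J.encard + 1 ≤ U.encard + V.encard := by
  by_cases hpJ : p ∈ J
  · exact ⟨J ∩ E₀, J ∩ E₁, Set.subset_insert _ _, Set.subset_insert _ _, hJ.left, hJ.right,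
      (encard_add_of_mem hE hJ.subset hpJ).ge⟩
  · have hcard := encard_add hE hJ.subset hpJ
    rcases hJ.insert_or with h | h
    · refine ⟨_, _, subset_rfl, Set.subset_insert _ _, h, hJ.right, ?_⟩
      rw [Set.encard_insert_of_notMem (fun h => hpJ h.1), ← hcard, add_right_comm]
    · refine ⟨_, _, Set.subset_insert _ _, subset_rfl, hJ.left, h, ?_⟩
      rw [Set.encard_insert_of_notMem (fun h => hpJ h.1), ← hcard, add_assoc]

/-- When I ∩ E₀ spans p, some x in it is traded for p, which keeps its size, and p is added to I ∩
E₁. Both sides then contain p, so the element found by augmentation differs from p; if it lies on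
the left, it also augments the original I ∩ E₀. -/
theorem augment_of_not_insert [M.Finite] (hE : E₀ ∩ E₁ = {p}) (hp : M.Indep {p})
    (hI : ParallelIndep M p E₀ E₁ I) (hpI : p ∉ I) (hpA : ¬ M.Indep (insert p (I ∩ E₀)))
    (hJ : ParallelIndep M p E₀ E₁ J) (hIJ : I.encard < J.encard) :
    ∃ e ∈ J, e ∉ I ∧ ParallelIndep M p E₀ E₁ (insert e I) := by
  obtain ⟨U, V, hUJ, hVJ, hU, hV, hUV⟩ := exists_large_sides hE hJ
  have hpB := hI.insert_or.resolve_left hpA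
  obtain ⟨x, hx, hi, hpn, hexch⟩ := hI.left.exists_exchange hp hpA
  have hpE : p ∈ E₀ ∩ E₁ := hE ▸ rfl
  have hsum : (insert p ((I ∩ E₀) \ {x})).encard + (insert p (I ∩ E₁)).encard
      < U.encard + V.encard := by
    rw [Set.encard_insert_of_notMem (fun h => hpI h.1.1),
      Set.encard_insert_of_notMem (fun h => hpI h.1), Set.encard_sdiff_singleton_add_one hx,
      ← add_assoc, encard_add hE hI.subset hpI]
    refine lt_of_lt_of_le ?_ hUV
    exact (ENat.add_lt_add_iff_right ENat.one_ne_top).mpr hIJ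
  rcases exists_insert_pair hi hpB hU hV hsum with ⟨y, hy, hyi⟩ | ⟨y, hy, hyi⟩
  · have hyp : y ≠ p := fun h => hy.2 (h ▸ Set.mem_insert _ _)
    obtain ⟨hyA, hyA'⟩ := hexch y hy.2 hyi
    have hyJ := (hUJ hy.1).resolve_left hyp
    exact ⟨y, hyJ.1, fun h => hyA ⟨h, hyJ.2⟩, insert_left hE hyJ.2 hyp hI.subset hyA' hpB⟩
  · have hyp : y ≠ p := fun h => hy.2 (h ▸ Set.mem_insert _ _)
    have hyJ := (hVJ hy.1).resolve_left hyp
    exact ⟨y, hyJ.1, fun h => hy.2 (.inr ⟨h, hyJ.2⟩),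
      insert_right hE hyJ.2 hyp hI.subset hI.left hyi⟩

/-- Adding p to the E₁-side of both I and J raises both counts by one. The new element is not p: on
the left because p ∉ J, on the right because p is already there. -/
theorem augment_of_insert [M.Finite] (hE : E₀ ∩ E₁ = {p})
    (hI : ParallelIndep M p E₀ E₁ I) (hpI : p ∉ I) (hpB : M.Indep (insert p (I ∩ E₁)))
    (hJ : ParallelIndep M p E₀ E₁ J) (hpJ : p ∉ J) (hpJ' : M.Indep (insert p (J ∩ E₁)))
    (hIJ : I.encard < J.encard) :
    ∃ e ∈ J, e ∉ I ∧ ParallelIndep M p E₀ E₁ (insert e I) := by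
  have hsum : (I ∩ E₀).encard + (insert p (I ∩ E₁)).encard
      < (J ∩ E₀).encard + (insert p (J ∩ E₁)).encard := by
    rw [Set.encard_insert_of_notMem (fun h => hpI h.1),
      Set.encard_insert_of_notMem (fun h => hpJ h.1), ← add_assoc, ← add_assoc,
      encard_add hE hI.subset hpI, encard_add hE hJ.subset hpJ]
    exact (ENat.add_lt_add_iff_right ENat.one_ne_top).mpr hIJ
  rcases exists_insert_pair hI.left hpB hJ.left hpJ' hsum with ⟨y, hy, hyi⟩ | ⟨y, hy, hyi⟩
  · exact ⟨y, hy.1.1, fun h => hy.2 ⟨h, hy.1.2⟩, insert_left hE hy.1.2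
      (fun h => hpJ (h ▸ hy.1.1)) hI.subset hyi hpB⟩
  · have hyp : y ≠ p := fun h => hy.2 (h ▸ Set.mem_insert _ _)
    have hyJ := hy.1.resolve_left hyp
    exact ⟨y, hyJ.1, fun h => hy.2 (.inr ⟨h, hyJ.2⟩),
      insert_right hE hyJ.2 hyp hI.subset hI.left hyi⟩

theorem augment [M.Finite] (hE : E₀ ∩ E₁ = {p}) (hp : M.Indep {p})
    (hI : ParallelIndep M p E₀ E₁ I) (hJ : ParallelIndep M p E₀ E₁ J)
    (hIJ : I.encard < J.encard) :
    ∃ e ∈ J, e ∉ I ∧ ParallelIndep M p E₀ E₁ (insert e I) := by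
  have hE' : E₁ ∩ E₀ = {p} := by rwa [Set.inter_comm]
  have hpE : p ∈ E₀ ∩ E₁ := hE ▸ rfl
  by_cases hpI : p ∈ I
  · obtain ⟨U, V, hUJ, hVJ, hU, hV, hUV⟩ := exists_large_sides hE hJ
    have hsum : (I ∩ E₀).encard + (I ∩ E₁).encard < U.encard + V.encard := by
      rw [encard_add_of_mem hE hI.subset hpI]
      exact lt_of_lt_of_le ((ENat.add_lt_add_iff_right ENat.one_ne_top).mpr hIJ) hUV
    have hA : insert p (I ∩ E₀) = I ∩ E₀ := Set.insert_eq_of_mem ⟨hpI, hpE.1⟩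
    have hB : insert p (I ∩ E₁) = I ∩ E₁ := Set.insert_eq_of_mem ⟨hpI, hpE.2⟩
    rcases exists_insert_pair hI.left hI.right hU hV hsum with ⟨y, hy, hyi⟩ | ⟨y, hy, hyi⟩
    · have hyp : y ≠ p := fun h => hy.2 (h ▸ ⟨hpI, hpE.1⟩)
      have hyJ := (hUJ hy.1).resolve_left hyp
      exact ⟨y, hyJ.1, fun h => hy.2 ⟨h, hyJ.2⟩,
        insert_left hE hyJ.2 hyp hI.subset hyi (hB.symm ▸ hI.right)⟩
    · have hyp : y ≠ p := fun h => hy.2 (h ▸ ⟨hpI, hpE.2⟩)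
      have hyJ := (hVJ hy.1).resolve_left hyp
      exact ⟨y, hyJ.1, fun h => hy.2 ⟨h, hyJ.2⟩,
        insert_right hE hyJ.2 hyp hI.subset hI.left (hB.symm ▸ hyi)⟩
  -- If p ∉ I and one side of I spans p, the exchange argument applies. Otherwise p can be added to
  -- either side, so p itself augments I if p ∈ J, and if not, the side is chosen to suit J.
  by_cases hpA : M.Indep (insert p (I ∩ E₀))
  swap
  · exact augment_of_not_insert hE hp hI hpI hpA hJ hIJ
  by_cases hpB : M.Indep (insert p (I ∩ E₁))
  swap
  · obtain ⟨e, he, heI, h⟩ := augment_of_not_insert hE' hp hI.symm hpI hpB hJ.symm hIJ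
    exact ⟨e, he, heI, h.symm⟩
  by_cases hpJ : p ∈ J
  · refine ⟨p, hpJ, hpI, Set.insert_subset (.inl hpE.1) hI.subset, ?_, ?_, .inl ?_⟩
    · rwa [Set.insert_inter_of_mem hpE.1]
    · rwa [Set.insert_inter_of_mem hpE.2]
    · rwa [Set.insert_inter_of_mem hpE.1, Set.insert_idem]
  rcases hJ.insert_or with h | h
  · obtain ⟨e, he, heI, h⟩ := augment_of_insert hE' hI.symm hpI hpA hJ.symm hpJ h hIJ
    exact ⟨e, he, heI, h.symm⟩
  · exact augment_of_insert hE hI hpI hpB hJ hpJ h hIJ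

end ParallelIndep

/-- The parallel connection, along `p`, of the restrictions of `M` to `E₀` and `E₁`. -/
def parallelGlue (M : Matroid γ) [M.Finite] {p : γ} {E₀ E₁ : Set γ} (hU : E₀ ∪ E₁ = M.E)
    (hE : E₀ ∩ E₁ = {p}) (hp : M.Indep {p}) : Matroid γ :=
  (IndepMatroid.ofFinite M.ground_finite (ParallelIndep M p E₀ E₁)
    ⟨Set.empty_subset _, by simp, by simp, by simpa using hp⟩
    (fun _ _ hJ hIJ => hJ.mono hIJ)
    (fun I J hI hJ hIJ => by
      refine hI.augment hE hp hJ ?_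
      have hIf := M.ground_finite.subset (hU ▸ hI.subset)
      have hJf := M.ground_finite.subset (hU ▸ hJ.subset)
      rwa [← hIf.cast_ncard_eq, ← hJf.cast_ncard_eq, Nat.cast_lt])
    (fun _ hI => hU ▸ hI.subset)).matroid

/-- A matroid of largest rank among those with given restrictions to `E₀` and `E₁` has all the
independent sets of the parallel connection. -/
theorem ParallelIndep.indep {M : Matroid γ} [M.Finite] {p : γ} {E₀ E₁ : Set γ}
    (hU : E₀ ∪ E₁ = M.E) (hE : E₀ ∩ E₁ = {p}) (hp : M.Indep {p})
    (hmax : ∀ N : Matroid γ, N.E = M.E → (∀ I ⊆ E₀, N.Indep I ↔ M.Indep I) →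
      (∀ I ⊆ E₁, N.Indep I ↔ M.Indep I) → N.eRank ≤ M.eRank)
    {X : Set γ} (hX : ParallelIndep M p E₀ E₁ X) : M.Indep X := by
  have hE' : E₁ ∩ E₀ = {p} := by rwa [Set.inter_comm]
  have hpE : p ∈ E₀ ∩ E₁ := hE ▸ rfl
  have hins : ∀ I : Set γ, insert p (I ∩ {p}) = {p} := fun I => by
    ext y; simp +contextual
  -- The glued matroid has the right restrictions: a subset of one side meets the other in at most
  -- p, and adding p to that intersection gives {p}, which is independent.
  have hrank := hmax (parallelGlue M hU hE hp) rfl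
    (fun I hI => ⟨fun h => Set.inter_eq_left.mpr hI ▸ ParallelIndep.left h, fun h => by
      have h1 : I ∩ E₁ = I ∩ {p} := by rw [← hE, ← Set.inter_assoc, Set.inter_eq_left.mpr hI]
      refine ⟨hI.trans Set.subset_union_left, h.subset Set.inter_subset_left,
        h.subset Set.inter_subset_left, .inr ?_⟩
      rwa [h1, hins]⟩)
    (fun I hI => ⟨fun h => Set.inter_eq_left.mpr hI ▸ ParallelIndep.right h, fun h => by
      have h1 : I ∩ E₀ = I ∩ {p} := by rw [← hE', ← Set.inter_assoc, Set.inter_eq_left.mpr hI]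
      refine ⟨hI.trans Set.subset_union_right, h.subset Set.inter_subset_left,
        h.subset Set.inter_subset_left, .inl ?_⟩
      rwa [h1, hins]⟩)
  -- The sides are kept variable so that F₀ can be whichever side admits p.
  have key : ∀ F₀ F₁ : Set γ, F₀ ∪ F₁ = M.E → F₀ ∩ F₁ = {p} →
      (∀ Y, ParallelIndep M p F₀ F₁ Y → Y.encard ≤ M.eRank) → X ⊆ F₀ ∪ F₁ →
      M.Indep (insert p (X ∩ F₀)) → M.Indep (X ∩ F₁) → M.Indep X := by
    intro F₀ F₁ hU hE hle hXF hX₀ hX₁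
    have hpE : p ∈ F₀ ∩ F₁ := hE ▸ rfl
    have hF₀ : F₀ ⊆ M.E := hU ▸ Set.subset_union_left
    have hF₁ : F₁ ⊆ M.E := hU ▸ Set.subset_union_right
    obtain ⟨B₀, hB₀, hXB₀⟩ := hX₀.subset_isBasis_of_subset
      (Set.insert_subset hpE.1 Set.inter_subset_right) hF₀
    obtain ⟨B₁, hB₁, hXB₁⟩ := hX₁.subset_isBasis_of_subset Set.inter_subset_right hF₁
    have hpB₀ : p ∈ B₀ := hXB₀ (Set.mem_insert _ _)
    -- The point p is dropped from B₀ because B₁ already spans it; the union still spans everything.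
    have hsub : X ⊆ B₀ \ {p} ∪ B₁ := by
      intro x hx
      by_cases hx₁ : x ∈ F₁
      · exact .inr (hXB₁ ⟨hx, hx₁⟩)
      · refine .inl ⟨hXB₀ (.inr ⟨hx, (hXF hx).resolve_right hx₁⟩), ?_⟩
        rintro rfl
        exact hx₁ hpE.2
    have hBE : B₀ \ {p} ∪ B₁ ⊆ M.E :=
      Set.union_subset (Set.sdiff_subset.trans hB₀.indep.subset_ground) hB₁.indep.subset_ground
    have hF₁cl : F₁ ⊆ M.closure (B₀ \ {p} ∪ B₁) :=
      hB₁.subset_closure.trans (M.closure_subset_closure Set.subset_union_right)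
    have hB₀cl : B₀ ⊆ M.closure (B₀ \ {p} ∪ B₁) := by
      intro x hx
      rcases eq_or_ne x p with rfl | hxp
      · exact hF₁cl hpE.2
      · exact M.mem_closure_of_mem' (.inl ⟨hx, hxp⟩) (hB₀.indep.subset_ground hx)
    have hspan : M.E ⊆ M.closure (B₀ \ {p} ∪ B₁) := hU ▸ Set.union_subset
      (hB₀.subset_closure.trans (M.closure_subset_closure_of_subset_closure hB₀cl)) hF₁cl
    have hrk : M.eRk (B₀ \ {p} ∪ B₁) = M.eRank := by
      rw [← eRk_closure_eq, eRk_eq_eRank hspan]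
    have hleft : (B₀ \ {p} ∪ B₁) ∩ F₀ ⊆ B₀ := by
      rintro x ⟨hx | hx, hx₀⟩
      · exact hx.1
      · have : x ∈ F₀ ∩ F₁ := ⟨hx₀, hB₁.subset hx⟩
        rw [hE] at this
        exact this ▸ hpB₀
    have hright : (B₀ \ {p} ∪ B₁) ∩ F₁ ⊆ B₁ := by
      rintro x ⟨hx | hx, hx₁⟩
      · have : x ∈ F₀ ∩ F₁ := ⟨hB₀.subset hx.1, hx₁⟩
        rw [hE] at this
        exact absurd this hx.2
      · exact hx
    have hpar : ParallelIndep M p F₀ F₁ (B₀ \ {p} ∪ B₁) :=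
      ⟨hBE.trans hU.ge, hB₀.indep.subset hleft, hB₁.indep.subset hright,
        .inl (hB₀.indep.subset (Set.insert_subset hpB₀ hleft))⟩
    have hfin : M.IsRkFinite (B₀ \ {p} ∪ B₁) := M.isRkFinite_set _
    -- A spanning set with no more elements than the rank is independent.
    exact (hfin.indep_of_encard_le_eRk (hrk ▸ hle _ hpar)).subset hsub
  have hle : ∀ Y, ParallelIndep M p E₀ E₁ Y → Y.encard ≤ M.eRank := fun Y hY =>
    (Indep.encard_le_eRank (M := parallelGlue M hU hE hp) hY).trans hrank
  rcases hX.insert_or with h | h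
  · exact key E₀ E₁ hU hE hle hX.subset h hX.right
  · exact key E₁ E₀ ((Set.union_comm _ _).trans hU) hE' (fun Y hY => hle Y hY.symm)
      hX.symm.subset h hX.left

end Matroid

/-! ### Dependent sets of a parallel connection -/

namespace PointedMatroid

variable {α β γ : Type*} {G₀ : PointedMatroid α} {G₁ : PointedMatroid β} {P : PointedMatroid γ}
  {f₀ : G₀.Pt → P.Pt} {f₁ : G₁.Pt → P.Pt}

/-- Being an embedding depends only on the restriction to the image. This makes a matroid with the
same restrictions as P a competitor in the maximality condition. -/
theorem IsEmbedding.indep_iff_of_restrict {G : PointedMatroid α} {f : G.Pt → P.Pt}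
    (hf : G.IsEmbedding P f) (N : Matroid γ) (hN : N.E = P.matroid.E)
    (h : ∀ I ⊆ Set.range (fun i => (f i : γ)), N.Indep I ↔ P.matroid.Indep I) :
    G.IsEmbedding ⟨N, P.base, hN.ge P.base_mem⟩ (fun i => ⟨f i, hN.ge (f i).2⟩) where
  injective i j hij := hf.injective (Subtype.ext (Subtype.mk.inj hij))
  map_base := by
    have h1 : (f G.basePt : γ) = P.base := congrArg Subtype.val hf.map_base
    exact Subtype.ext h1
  indep_iff I := (h _ (Set.image_subset_range _ _)).trans (hf.indep_iff I)

theorem IsUnion.range_union (h : G₀.IsUnion G₁ P f₀ f₁) :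
    Set.range (fun i => (f₀ i : γ)) ∪ Set.range (fun j => (f₁ j : γ)) = P.matroid.E := by
  have h1 := congrArg (Set.image Subtype.val) h.union_eq
  rw [Set.image_union, ← Set.range_comp, ← Set.range_comp, Set.image_univ, Subtype.range_coe] at h1
  exact h1

theorem IsUnion.range_inter (h : G₀.IsUnion G₁ P f₀ f₁) :
    Set.range (fun i => (f₀ i : γ)) ∩ Set.range (fun j => (f₁ j : γ)) = {P.base} := by
  have h1 := congrArg (Set.image Subtype.val) h.inter_eq
  rw [Set.image_inter Subtype.val_injective, ← Set.range_comp, ← Set.range_comp,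
    Set.image_singleton] at h1
  exact h1

theorem IsUnion.finite [G₀.matroid.Finite] [G₁.matroid.Finite] (h : G₀.IsUnion G₁ P f₀ f₁) :
    P.matroid.Finite := by
  have := G₀.matroid.ground_finite.to_subtype
  have := G₁.matroid.ground_finite.to_subtype
  exact ⟨h.range_union ▸ (Set.finite_range _).union (Set.finite_range _)⟩

/-- A dependent set of a parallel connection contains a dependent set of one of the two sides, or
both of its sides span the base point. -/
theorem IsParallelConnection.dep [G₀.matroid.Finite] [G₁.matroid.Finite]
    (hP : G₀.IsParallelConnection G₁ P f₀ f₁) (h₀ : G₀.matroid.IsNonloop G₀.base)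
    {X : Set γ} (hX : P.matroid.Dep X) :
    P.matroid.Dep (X ∩ Set.range (fun i => (f₀ i : γ))) ∨
    P.matroid.Dep (X ∩ Set.range (fun j => (f₁ j : γ))) ∨
    (P.matroid.Dep (insert P.base (X ∩ Set.range (fun i => (f₀ i : γ)))) ∧
      P.matroid.Dep (insert P.base (X ∩ Set.range (fun j => (f₁ j : γ))))) := by
  have := hP.isUnion.finite
  have hXE := hX.subset_ground
  have hinter : ∀ Y, X ∩ Y ⊆ P.matroid.E := fun Y => Set.inter_subset_left.trans hXE
  have hins : ∀ Y, insert P.base (X ∩ Y) ⊆ P.matroid.E :=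
    fun Y => Set.insert_subset P.base_mem (hinter Y)
  by_contra! h
  obtain ⟨hl, hr, hlr⟩ := h
  rw [Matroid.not_dep_iff (hinter _)] at hl hr
  rw [Matroid.not_dep_iff (hins _), ← Matroid.not_indep_iff (hins _)] at hlr
  replace hlr := or_iff_not_imp_left.mpr hlr
  have hp : P.matroid.Indep {P.base} := by
    have h1 := (hP.isUnion.left.indep_iff {G₀.basePt}).mpr (by
      simpa [basePt, Matroid.indep_singleton] using h₀)
    have hb : (f₀ G₀.basePt : γ) = P.base := congrArg Subtype.val hP.isUnion.left.map_base
    rwa [Set.image_singleton, hb] at h1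
  refine hX.not_indep (Matroid.ParallelIndep.indep hP.isUnion.range_union hP.isUnion.range_inter hp
    -- The competitor N has the ground set of P, so the same inclusions f₀ and f₁ present it as a
    -- union.
    (fun N hNE hN₀ hN₁ => ?_) ⟨hXE.trans hP.isUnion.range_union.ge, hl, hr, hlr⟩)
  refine hP.eRank_le ⟨N, P.base, hNE.ge P.base_mem⟩ (fun i => ⟨f₀ i, hNE.ge (f₀ i).2⟩)
    (fun i => ⟨f₁ i, hNE.ge (f₁ i).2⟩) ⟨hP.isUnion.left.indep_iff_of_restrict N hNE hN₀,
      hP.isUnion.right.indep_iff_of_restrict N hNE hN₁, ?_, ?_⟩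
  · refine Set.eq_univ_of_forall fun ⟨x, hx⟩ => ?_
    rcases hP.isUnion.range_union.ge (hNE ▸ hx) with ⟨i, hi⟩ | ⟨i, hi⟩
    · exact .inl ⟨i, Subtype.ext hi⟩
    · exact .inr ⟨i, Subtype.ext hi⟩
  · refine Set.image_injective.mpr Subtype.val_injective ?_
    rw [Set.image_inter Subtype.val_injective, ← Set.range_comp, ← Set.range_comp,
      Set.image_singleton]
    exact hP.isUnion.range_inter

end PointedMatroid

/-! ### Homomorphisms from the exterior algebra and the boundary map -/

namespace OrlikSolomon

variable {R : Type*} [CommRing R] {X Y : Type*} {A : Type*} [Ring A] [Algebra R A]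

/-- The elements `g i` have square zero and anticommute with each other. -/
structure IsExterior (g : X → A) : Prop where
  mul_self : ∀ i, g i * g i = 0
  anticomm : ∀ i j, g i * g j + g j * g i = 0

theorem IsExterior.linearCombination_anticomm {g : X → A} (hg : IsExterior g) (m n : X →₀ R) :
    Finsupp.linearCombination R g m * Finsupp.linearCombination R g n
      + Finsupp.linearCombination R g n * Finsupp.linearCombination R g m = 0 := by
  induction m using Finsupp.induction_linear with
  | zero => simp
  | add m m' h h' =>
    rw [map_add, add_mul, mul_add, add_add_add_comm, h, h', add_zero]
  | single i r =>
    induction n using Finsupp.induction_linear with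
    | zero => simp
    | add m m' h h' =>
      rw [map_add, add_mul, mul_add, add_add_add_comm, h, h', add_zero]
    | single j s =>
      simp only [Finsupp.linearCombination_single, smul_mul_smul_comm]
      rw [mul_comm s r, ← smul_add, hg.anticomm, smul_zero]

theorem IsExterior.linearCombination_mul_self {g : X → A} (hg : IsExterior g) (m : X →₀ R) :
    Finsupp.linearCombination R g m * Finsupp.linearCombination R g m = 0 := by
  induction m using Finsupp.induction_linear with
  | zero => simp
  | add m n hm hn =>
    rw [map_add, add_mul, mul_add, mul_add, hm, hn, zero_add, add_zero,
      hg.linearCombination_anticomm]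
  | single i r =>
    simp only [Finsupp.linearCombination_single, smul_mul_smul_comm, hg.mul_self, smul_zero]

variable (R) in
/-- The homomorphism from the exterior algebra with prescribed values on the generators. -/
def extLift (g : X → A) (hg : IsExterior g) : Ext R X →ₐ[R] A :=
  ExteriorAlgebra.lift R ⟨Finsupp.linearCombination R g, hg.linearCombination_mul_self⟩

@[simp]
theorem extLift_e (g : X → A) (hg : IsExterior g) (i : X) : extLift R g hg (e R i) = g i := by
  simp [extLift, e]

theorem ext_algHom {φ ψ : Ext R X →ₐ[R] A} (h : ∀ i, φ (e R i) = ψ (e R i)) : φ = ψ := by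
  refine ExteriorAlgebra.hom_ext (Finsupp.lhom_ext' fun i => LinearMap.ext_ring ?_)
  exact h i

theorem isExterior_e : IsExterior (e R : X → Ext R X) :=
  ⟨fun _ => ExteriorAlgebra.ι_sq_zero _, fun _ _ => ExteriorAlgebra.ι_add_mul_swap _ _⟩

theorem IsExterior.map {B : Type*} [Ring B] [Algebra R B] {g : X → A} (hg : IsExterior g)
    (φ : A →ₐ[R] B) : IsExterior (fun i => φ (g i)) :=
  ⟨fun i => by rw [← map_mul, hg.mul_self, map_zero],
    fun i j => by rw [← map_mul, ← map_mul, ← map_add, hg.anticomm, map_zero]⟩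

theorem IsExterior.comp {g : X → A} (hg : IsExterior g) (f : Y → X) : IsExterior (g ∘ f) :=
  ⟨fun _ => hg.mul_self _, fun _ _ => hg.anticomm _ _⟩

theorem IsExterior.sub_const {g : X → A} (hg : IsExterior g) (k : X) :
    IsExterior (fun i => g i - g k) := by
  have key : ∀ i j, (g i - g k) * (g j - g k) = g i * g j - g i * g k - g k * g j := fun i j => by
    rw [sub_mul, mul_sub, mul_sub, hg.mul_self k, sub_zero]
  constructor
  · intro i
    rw [key, hg.mul_self, zero_sub, ← neg_add', hg.anticomm, neg_zero]
  · intro i j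
    have h1 := hg.anticomm i j
    have h2 := hg.anticomm i k
    have h3 := hg.anticomm j k
    rw [key, key]
    calc _ = (g i * g j + g j * g i) - (g i * g k + g k * g i) - (g j * g k + g k * g j) := by abel
      _ = 0 := by rw [h1, h2, h3, sub_zero, sub_zero]

/-! ### Products of generators -/

@[simp]
theorem eProd_nil : eProd R ([] : List X) = 1 := rfl

@[simp]
theorem eProd_cons (i : X) (S : List X) : eProd R (i :: S) = e R i * eProd R S := by
  simp [eProd]

theorem eProd_append (S S' : List X) : eProd R (S ++ S') = eProd R S * eProd R S' := by
  simp [eProd]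

/-- The sign is left open since only vanishing is at stake. -/
theorem eProd_perm {S S' : List X} (h : S.Perm S') :
    eProd R S = eProd R S' ∨ eProd R S = -eProd R S' := by
  induction h with
  | nil => exact .inl rfl
  | cons i _ ih =>
    rcases ih with ih | ih <;> simp [ih]
  | swap i j S =>
    right
    simp only [eProd_cons, ← mul_assoc]
    rw [eq_neg_of_add_eq_zero_left (isExterior_e.anticomm j i), neg_mul]
  | trans _ _ ih ih' =>
    rcases ih with ih | ih <;> rcases ih' with ih' | ih' <;> simp [ih, ih']

theorem boundary_one : boundary R X 1 = 0 := by simp [boundary]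

theorem boundary_eProd_mul (S : List X) (y : Ext R X) :
    boundary R X (eProd R S * y)
      = boundary R X (eProd R S) * y + (-1 : R) ^ S.length • (eProd R S * boundary R X y) := by
  induction S with
  | nil => simp [boundary_one]
  | cons i S ih =>
    simp only [eProd_cons, mul_assoc, boundary_e_mul, ih, List.length_cons, pow_succ, sub_mul,
      mul_add, mul_neg, mul_one, neg_smul, mul_smul_comm]
    abel

/-- An algebra homomorphism kills the product of the generators in `S` and its boundary. -/
structure Kills (φ : Ext R X →ₐ[R] A) (S : List X) : Prop where
  eProd : φ (eProd R S) = 0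
  boundary : φ (boundary R X (OrlikSolomon.eProd R S)) = 0

variable {φ : Ext R X →ₐ[R] A}

theorem Kills.perm {S S' : List X} (h : Kills φ S) (hS : S.Perm S') : Kills φ S' := by
  rcases eProd_perm (R := R) hS.symm with h1 | h1
  · exact ⟨by rw [h1, h.eProd], by rw [h1, h.boundary]⟩
  · exact ⟨by rw [h1, map_neg, h.eProd, neg_zero], by rw [h1, map_neg, map_neg, h.boundary, neg_zero]⟩

/-- By the Leibniz rule ∂(e_S e_{S'}) involves both e_S and ∂e_S, which is why `Kills` records both.
-/
theorem Kills.append {S : List X} (h : Kills φ S) (S' : List X) : Kills φ (S ++ S') := by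
  constructor
  · rw [eProd_append, map_mul, h.eProd, zero_mul]
  · rw [eProd_append, boundary_eProd_mul, map_add, map_smul, map_mul, map_mul, h.eProd, h.boundary,
      zero_mul, zero_mul, smul_zero, add_zero]

theorem Kills.of_filter {S : List X} {q : X → Prop} [DecidablePred q]
    (h : Kills φ (S.filter (fun i => decide (q i)))) : Kills φ S :=
  (h.append _).perm (List.filter_append_perm (fun i => decide (q i)) S)

/-- Each Leibniz term keeps one factor undifferentiated, so no assumption on the boundaries is
needed. -/
theorem kills_append_of_eProd {S S' : List X} (h : φ (eProd R S) = 0) (h' : φ (eProd R S') = 0) :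
    Kills φ (S ++ S') := by
  constructor
  · rw [eProd_append, map_mul, h, zero_mul]
  · rw [eProd_append, boundary_eProd_mul, map_add, map_smul, map_mul, map_mul, h, h',
      zero_mul, mul_zero, smul_zero, add_zero]

theorem e_mul_eProd_of_mem {i : X} {S : List X} (hi : i ∈ S) : e R i * eProd R S = 0 := by
  classical
  rcases eProd_perm (R := R) (List.perm_cons_erase hi) with h | h <;>
  simp [h, ← mul_assoc, isExterior_e.mul_self]

/-- Obtained by applying ∂ to e_i e_S = 0. -/
theorem eProd_eq_of_mem {i : X} {S : List X} (hi : i ∈ S) :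
    eProd R S = e R i * boundary R X (eProd R S) := by
  have h := congrArg (boundary R X) (e_mul_eProd_of_mem (R := R) hi)
  rwa [boundary_e_mul, map_zero, sub_eq_zero] at h

/-- The product e_S is a multiple of its boundary. The empty tuple must be excluded: its product is
1, with boundary 0. -/
theorem kills_of_boundary {S : List X} (hS : S ≠ []) (h : φ (boundary R X (eProd R S)) = 0) :
    Kills φ S := by
  obtain ⟨i, hi⟩ := List.exists_mem_of_ne_nil S hS
  exact ⟨by rw [eProd_eq_of_mem hi, map_mul, h, mul_zero], h⟩

theorem eProd_killed_of_cons {k : X} {S : List X} (hk : φ (e R k) = 0)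
    (h : φ (boundary R X (eProd R (k :: S))) = 0) : φ (eProd R S) = 0 := by
  rwa [eProd_cons, boundary_e_mul, map_sub, map_mul, hk, zero_mul, sub_zero] at h

theorem extLift_comp_map (g : Y → A) (hg : IsExterior g) (f : X → Y) (S : List X) :
    extLift R g hg (eProd R (S.map f)) = extLift R (g ∘ f) (hg.comp f) (eProd R S) ∧
    extLift R g hg (boundary R Y (eProd R (S.map f)))
      = extLift R (g ∘ f) (hg.comp f) (boundary R X (eProd R S)) := by
  induction S with
  | nil => simp [boundary_one]
  | cons i S ih => simp [boundary_e_mul, ih]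

theorem map_extLift {B : Type*} [Ring B] [Algebra R B] (ψ : A →ₐ[R] B) (g : X → A)
    (hg : IsExterior g) (x : Ext R X) :
    ψ (extLift R g hg x) = extLift R (fun i => ψ (g i)) (hg.map ψ) x := by
  have : ψ.comp (extLift R g hg) = extLift R (fun i => ψ (g i)) (hg.map ψ) :=
    ext_algHom fun i => by simp
  exact DFunLike.congr_fun this x

/-- The substitution e_i ↦ e_i - e_k is x ↦ ∂(e_k x) = x - e_k ∂x, which fixes boundaries because ∂²
= 0. The induction for the second formula uses the first. -/
theorem extLift_sub_const (k : X) (S : List X) :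
    extLift R _ (isExterior_e.sub_const k) (eProd R S)
      = eProd R S - e R k * boundary R X (eProd R S) ∧
    extLift R _ (isExterior_e.sub_const k) (boundary R X (eProd R S))
      = boundary R X (eProd R S) := by
  induction S with
  | nil => simp [boundary_one]
  | cons i S ih =>
    have h1 : e R k * (e R i * boundary R X (eProd R S))
        = -(e R i * (e R k * boundary R X (eProd R S))) := by
      rw [← mul_assoc, ← mul_assoc, ← neg_mul,
        eq_neg_of_add_eq_zero_left (isExterior_e.anticomm k i)]
    have h2 : e R k * (e R k * boundary R X (eProd R S)) = 0 := by
      rw [← mul_assoc, isExterior_e.mul_self, zero_mul]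
    constructor
    · simp only [eProd_cons, map_mul, extLift_e, boundary_e_mul, ih, sub_mul, mul_sub, h1, h2]
      abel
    · simp only [eProd_cons, map_mul, map_sub, extLift_e, boundary_e_mul, ih, sub_mul]
      abel

end OrlikSolomon

/-! ### Homomorphisms from the Orlik–Solomon algebra, degrees and graded commutativity -/

namespace OrlikSolomon

variable {R : Type*} [CommRing R] {α : Type*} {M : Matroid α} {A : Type*} [Ring A] [Algebra R A]

/-- The homomorphism from the Orlik-Solomon algebra induced by a homomorphism from the exterior
algebra that kills the relations. -/
def osLift (φ : Ext R M.E →ₐ[R] A)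
    (h : ∀ S, IsDependent M S → φ (boundary R M.E (eProd R S)) = 0) : OS R M →ₐ[R] A :=
  RingQuot.liftAlgHom R ⟨φ, by
    rintro _ _ ⟨S, hS⟩
    rw [map_zero, h S hS]⟩

@[simp]
theorem osLift_mk (φ : Ext R M.E →ₐ[R] A)
    (h : ∀ S, IsDependent M S → φ (boundary R M.E (eProd R S)) = 0) (x : Ext R M.E) :
    osLift φ h (mk R M x) = φ x :=
  RingQuot.liftAlgHom_mkAlgHom_apply R _ _ x

theorem osLift_a (φ : Ext R M.E →ₐ[R] A)
    (h : ∀ S, IsDependent M S → φ (boundary R M.E (eProd R S)) = 0) (i : M.E) :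
    osLift φ h (a R M i) = φ (e R i) := osLift_mk φ h _

theorem isExterior_a : IsExterior (a R M) := isExterior_e.map (mk R M)

theorem extLift_a (x : Ext R M.E) : extLift R (a R M) isExterior_a x = mk R M x := by
  have : extLift R (a R M) isExterior_a = mk R M := ext_algHom fun i => by simp [a]
  rw [this]

/-- An algebra homomorphism that sends the generators to elements of degree one respects the
gradings. -/
theorem map_mem_of_mem_grading (ℬ : ℕ → Submodule R A) [SetLike.GradedMonoid ℬ]
    (F : OS R M →ₐ[R] A) (hF : ∀ i, F (a R M i) ∈ ℬ 1) {p : ℕ} {x : OS R M}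
    (hx : x ∈ grading R M p) : F x ∈ ℬ p := by
  obtain ⟨y, hy, rfl⟩ := hx
  change F (mk R M y) ∈ ℬ p
  induction hy using Submodule.pow_induction_on_left' with
  | algebraMap r =>
    rw [AlgHom.commutes, AlgHom.commutes]
    exact SetLike.algebraMap_mem_graded _ r
  | add x y i hx hy ihx ihy =>
    rw [map_add, map_add]
    exact add_mem ihx ihy
  | mem_mul m hm i x hx ih =>
    obtain ⟨m, rfl⟩ := hm
    rw [map_mul, map_mul, Nat.succ_eq_one_add]
    refine SetLike.GradedMul.mul_mem ?_ ih
    induction m using Finsupp.induction_linear with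
    | zero => simp
    | add m n hm hn =>
      rw [map_add, map_add, map_add]
      exact add_mem hm hn
    | single j r =>
      rw [← mul_one r, ← smul_eq_mul, ← Finsupp.smul_single, map_smul, map_smul, map_smul]
      exact Submodule.smul_mem _ _ (hF j)

theorem ι_mul_of_mem {X : Type*} (m : X →₀ R) {q : ℕ} {y : Ext R X}
    (hy : y ∈ ⋀[R]^q (X →₀ R)) :
    ExteriorAlgebra.ι R m * y = (-1 : R) ^ q • (y * ExteriorAlgebra.ι R m) := by
  induction hy using Submodule.pow_induction_on_left' with
  | algebraMap r => simp [Algebra.commutes]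
  | add x y i hx hy ihx ihy => rw [mul_add, add_mul, ihx, ihy, smul_add]
  | mem_mul n hn i x hx ih =>
    obtain ⟨n, rfl⟩ := hn
    rw [← mul_assoc, eq_neg_of_add_eq_zero_left (ExteriorAlgebra.ι_add_mul_swap m n), neg_mul,
      mul_assoc, ih, mul_smul_comm, pow_succ, mul_assoc, mul_neg_one, neg_smul]

theorem ext_mul_of_mem {X : Type*} {p q : ℕ} {x y : Ext R X}
    (hx : x ∈ ⋀[R]^p (X →₀ R)) (hy : y ∈ ⋀[R]^q (X →₀ R)) :
    x * y = (-1 : R) ^ (q * p) • (y * x) := by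
  induction hx using Submodule.pow_induction_on_left' with
  | algebraMap r => simp [Algebra.commutes]
  | add x x' i hx hx' ihx ihx' => rw [mul_add, add_mul, ihx, ihx', smul_add]
  | mem_mul m hm i x hx ih =>
    obtain ⟨m, rfl⟩ := hm
    rw [mul_assoc, ih, mul_smul_comm, ← mul_assoc, ι_mul_of_mem m hy, smul_mul_assoc, smul_smul,
      ← pow_add, mul_assoc, Nat.mul_succ]

theorem mul_of_mem_grading {p q : ℕ} {x y : OS R M}
    (hx : x ∈ grading R M p) (hy : y ∈ grading R M q) :
    x * y = (-1 : R) ^ (q * p) • (y * x) := by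
  obtain ⟨x, hx, rfl⟩ := hx
  obtain ⟨y, hy, rfl⟩ := hy
  change mk R M x * mk R M y = (-1 : R) ^ (q * p) • (mk R M y * mk R M x)
  rw [← map_mul, ext_mul_of_mem hx hy, map_smul, map_mul]

end OrlikSolomon

/-! ### Retraction onto the affine algebra and functoriality -/

namespace PointedMatroid

open OrlikSolomon

variable {R : Type*} [CommRing R] {α γ : Type*} {G : PointedMatroid α} {P : PointedMatroid γ}

theorem gen_mem (i : G.Pt) : G.gen R i ∈ G.affineGrading R 1 :=
  Submodule.sub_mem _ (mk_mem_grading (e_mem i)) (mk_mem_grading (e_mem _))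

theorem gen_base : G.gen R G.basePt = 0 := Subtype.ext (sub_self _)

theorem isExterior_gen : IsExterior (G.gen R) :=
  ⟨fun i => Subtype.ext ((isExterior_a.sub_const G.basePt).mul_self i),
    fun i j => Subtype.ext ((isExterior_a.sub_const G.basePt).anticomm i j)⟩

theorem affineOS_algHom_ext {A : Type*} [Ring A] [Algebra R A] {φ ψ : G.affineOS R →ₐ[R] A}
    (h : ∀ i, φ (G.gen R i) = ψ (G.gen R i)) : φ = ψ := by
  refine AlgHom.adjoin_ext ?_
  rintro _ ⟨i, rfl⟩
  exact h i

variable (R G) in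
/-- The retraction of the Orlik-Solomon algebra onto the affine Orlik-Solomon algebra. -/
def retract : OS R G.matroid →ₐ[R] G.affineOS R :=
  osLift (extLift R (G.gen R) isExterior_gen) fun S hS => by
    refine Subtype.ext ?_
    -- Lifting along a_i - a_0 is the substitution e_i ↦ e_i - e_0 followed by the quotient map; the
    -- substitution fixes ∂e_S, which the quotient map kills.
    have h1 := map_extLift (G.affineOS R).val (G.gen R) isExterior_gen
      (boundary R _ (eProd R S))
    have h2 := map_extLift (OrlikSolomon.mk R G.matroid) _ (isExterior_e.sub_const G.basePt)
      (boundary R _ (eProd R S))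
    rw [(extLift_sub_const G.basePt S).2, mk_boundary hS] at h2
    refine h1.trans (Eq.trans ?_ h2.symm)
    congr 2
    funext i
    exact (map_sub (OrlikSolomon.mk R G.matroid) _ _).symm

theorem retract_a (i : G.Pt) : retract R G (a R G.matroid i) = G.gen R i := by
  simp [retract, osLift_a]

theorem IsEmbedding.isDependent_map {f : G.Pt → P.Pt} (hf : G.IsEmbedding P f) (S : List G.Pt) :
    IsDependent P.matroid (S.map f) ↔ IsDependent G.matroid S := by
  have h1 : {x | ∃ i ∈ S.map f, (i : γ) = x} = (fun i => (f i : γ)) '' {i : G.Pt | i ∈ S} := by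
    ext x
    constructor
    · rintro ⟨_, hi, rfl⟩
      obtain ⟨j, hj, rfl⟩ := List.mem_map.mp hi
      exact ⟨j, hj, rfl⟩
    · rintro ⟨i, hi, rfl⟩
      exact ⟨f i, List.mem_map_of_mem hi, rfl⟩
  have h2 : {x | ∃ i ∈ S, (i : α) = x} = (fun i : G.Pt => (i : α)) '' {i : G.Pt | i ∈ S} := rfl
  have h3 : {x | ∃ i ∈ S.map f, (i : γ) = x} ⊆ P.matroid.E := by
    rintro _ ⟨i, _, rfl⟩; exact i.2
  have h4 : {x | ∃ i ∈ S, (i : α) = x} ⊆ G.matroid.E := by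
    rintro _ ⟨i, _, rfl⟩; exact i.2
  rw [IsDependent, IsDependent, ← Matroid.not_indep_iff h3, ← Matroid.not_indep_iff h4, h1, h2,
    hf.indep_iff]

/-- The homomorphism of Orlik-Solomon algebras induced by an embedding, followed by the retraction
onto the affine Orlik-Solomon algebra. -/
def IsEmbedding.osMap {f : G.Pt → P.Pt} (hf : G.IsEmbedding P f) :
    OS R G.matroid →ₐ[R] P.affineOS R :=
  (retract R P).comp <|
    osLift (extLift R (a R P.matroid ∘ f) (isExterior_a.comp f)) fun S hS => by
      rw [← (extLift_comp_map (a R P.matroid) isExterior_a f S).2, extLift_a]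
      exact mk_boundary ((hf.isDependent_map S).mpr hS)

theorem IsEmbedding.osMap_a {f : G.Pt → P.Pt} (hf : G.IsEmbedding P f) (i : G.Pt) :
    hf.osMap (a R G.matroid i) = P.gen R (f i) := by
  simp [osMap, osLift_a, retract_a]

/-- The homomorphism of affine Orlik-Solomon algebras induced by an embedding. -/
def IsEmbedding.affineMap {f : G.Pt → P.Pt} (hf : G.IsEmbedding P f) :
    G.affineOS R →ₐ[R] P.affineOS R := hf.osMap.comp (G.affineOS R).val

theorem IsEmbedding.affineMap_gen {f : G.Pt → P.Pt} (hf : G.IsEmbedding P f) (i : G.Pt) :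
    hf.affineMap (G.gen R i) = P.gen R (f i) := by
  change hf.osMap (a R G.matroid i - a R G.matroid G.basePt) = _
  rw [map_sub, osMap_a, osMap_a, hf.map_base, gen_base, sub_zero]

/-- Degree in the affine algebra is inherited from the ambient one, where it is defined by lifts to
the exterior algebra. It is therefore tracked through `osMap`, which is defined on the ambient
algebra. -/
theorem IsEmbedding.affineMap_mem {f : G.Pt → P.Pt} (hf : G.IsEmbedding P f) {p : ℕ}
    {x : G.affineOS R} (hx : x ∈ G.affineGrading R p) : hf.affineMap x ∈ P.affineGrading R p :=
  map_mem_of_mem_grading (P.affineGrading R) hf.osMap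
    (fun i => by rw [osMap_a]; exact gen_mem _) hx

theorem mul_of_mem_affineGrading {p q : ℕ} {x y : G.affineOS R}
    (hx : x ∈ G.affineGrading R p) (hy : y ∈ G.affineGrading R q) :
    x * y = (-1 : R) ^ (q * p) • (y * x) :=
  Subtype.ext (mul_of_mem_grading hx hy)

end PointedMatroid

/-! ### The grading of the tensor product -/

section tensorGrading

variable {R A B : Type*} [CommRing R] [Ring A] [Ring B] [Algebra R A] [Algebra R B]
  {𝒜 : ℕ → Submodule R A} {ℬ : ℕ → Submodule R B} [GradedAlgebra 𝒜] [GradedAlgebra ℬ]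

theorem tmul_mul_tmul_of_mem {q p' : ℕ} (x : A) {y : B} {x' : A} (y' : B) (hy : y ∈ ℬ q)
    (hx' : x' ∈ 𝒜 p') :
    (x ᵍ⊗ₜ[R] y * x' ᵍ⊗ₜ[R] y' : 𝒜 ᵍ⊗[R] ℬ)
      = (-1 : R) ^ (q * p') • ((x * x') ᵍ⊗ₜ[R] (y * y')) := by
  have h := GradedTensorProduct.tmul_coe_mul_coe_tmul 𝒜 ℬ x ⟨y, hy⟩ ⟨x', hx'⟩ y'
  refine h.trans ?_
  -- Parity reconciles the sign taken in the units of ℤ with the sign taken in R.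
  rcases Nat.even_or_odd (q * p') with h | h <;> simp [h.neg_one_pow]

theorem tmul_mem_tensorGrading {p q : ℕ} {x : A} {y : B} (hx : x ∈ 𝒜 p) (hy : y ∈ ℬ q) :
    x ᵍ⊗ₜ[R] y ∈ tensorGrading 𝒜 ℬ (p + q) :=
  Submodule.subset_span ⟨p, q, rfl, x, hx, y, hy, rfl⟩

/-- Multiplicativity is what lets `map_mem_of_mem_grading` apply to homomorphisms into the tensor
product. -/
instance : SetLike.GradedMonoid (tensorGrading 𝒜 ℬ) where
  one_mem := by
    have h : (1 : A) ᵍ⊗ₜ[R] (1 : B) ∈ tensorGrading 𝒜 ℬ (0 + 0) :=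
      tmul_mem_tensorGrading SetLike.GradedOne.one_mem SetLike.GradedOne.one_mem
    exact h
  mul_mem m n s t hs ht := by
    have h := Submodule.mul_mem_mul hs ht
    rw [tensorGrading, tensorGrading, Submodule.span_mul_span] at h
    refine Submodule.span_le.mpr ?_ h
    rintro _ ⟨_, ⟨p, q, rfl, x, hx, y, hy, rfl⟩, _, ⟨p', q', rfl, x', hx', y', hy', rfl⟩, rfl⟩
    change (x ᵍ⊗ₜ[R] y * x' ᵍ⊗ₜ[R] y' : 𝒜 ᵍ⊗[R] ℬ) ∈ tensorGrading 𝒜 ℬ (p + q + (p' + q'))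
    rw [tmul_mul_tmul_of_mem x y' hy hx', add_add_add_comm]
    exact Submodule.smul_mem _ _ (tmul_mem_tensorGrading (SetLike.GradedMul.mul_mem hx hx')
      (SetLike.GradedMul.mul_mem hy hy'))

theorem zero_gradedTmul (y : B) : (0 ᵍ⊗ₜ[R] y : 𝒜 ᵍ⊗[R] ℬ) = 0 :=
  (congrArg (GradedTensorProduct.of R 𝒜 ℬ) (TensorProduct.zero_tmul A y)).trans
    (map_zero (GradedTensorProduct.of R 𝒜 ℬ))

theorem gradedTmul_zero (x : A) : (x ᵍ⊗ₜ[R] 0 : 𝒜 ᵍ⊗[R] ℬ) = 0 :=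
  (congrArg (GradedTensorProduct.of R 𝒜 ℬ) (TensorProduct.tmul_zero B x)).trans
    (map_zero (GradedTensorProduct.of R 𝒜 ℬ))

theorem tmul_one_mem_tensorGrading {p : ℕ} {x : A} (hx : x ∈ 𝒜 p) :
    x ᵍ⊗ₜ[R] (1 : B) ∈ tensorGrading 𝒜 ℬ p :=
  tmul_mem_tensorGrading (q := 0) hx SetLike.GradedOne.one_mem

theorem one_tmul_mem_tensorGrading {q : ℕ} {y : B} (hy : y ∈ ℬ q) :
    (1 : A) ᵍ⊗ₜ[R] y ∈ tensorGrading 𝒜 ℬ q :=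
  Submodule.subset_span ⟨0, q, zero_add q, 1, SetLike.GradedOne.one_mem, y, hy, rfl⟩

theorem map_mem_of_mem_tensorGrading {C : Type*} [Ring C] [Algebra R C] (𝒞 : ℕ → Submodule R C)
    [SetLike.GradedMonoid 𝒞] (F : (𝒜 ᵍ⊗[R] ℬ) →ₐ[R] C) {f : A → C} {g : B → C}
    (hF : ∀ x y, F (x ᵍ⊗ₜ[R] y) = f x * g y) (hf : ∀ p, ∀ x ∈ 𝒜 p, f x ∈ 𝒞 p)
    (hg : ∀ q, ∀ y ∈ ℬ q, g y ∈ 𝒞 q) {n : ℕ} {t : 𝒜 ᵍ⊗[R] ℬ} (ht : t ∈ tensorGrading 𝒜 ℬ n) :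
    F t ∈ 𝒞 n := by
  refine (Submodule.span_le (p := (𝒞 n).comap F.toLinearMap)).mpr ?_ ht
  rintro _ ⟨p, q, rfl, x, hx, y, hy, rfl⟩
  change F (x ᵍ⊗ₜ[R] y) ∈ 𝒞 (p + q)
  rw [hF]
  exact SetLike.GradedMul.mul_mem (hf p x hx) (hg q y hy)

end tensorGrading

/-! ### The isomorphism and its inverse -/

namespace PointedMatroid

open OrlikSolomon

variable {R : Type*} [CommRing R] {α β γ : Type*} {G₀ : PointedMatroid α} {G₁ : PointedMatroid β}
  {P : PointedMatroid γ} {f₀ : G₀.Pt → P.Pt} {f₁ : G₁.Pt → P.Pt}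

theorem left_mul_right (x : G₀.affineOS R) (y : G₁.affineOS R) :
    (x ᵍ⊗ₜ[R] 1 * 1 ᵍ⊗ₜ[R] y : G₀.affineGrading R ᵍ⊗[R] G₁.affineGrading R) = x ᵍ⊗ₜ[R] y :=
  GradedTensorProduct.tmul_one_mul_one_tmul _ _ x y

theorem right_mul_left {x : G₀.affineOS R} {y : G₁.affineOS R}
    (hx : x ∈ G₀.affineGrading R 1) (hy : y ∈ G₁.affineGrading R 1) :
    (1 ᵍ⊗ₜ[R] y * x ᵍ⊗ₜ[R] 1 : G₀.affineGrading R ᵍ⊗[R] G₁.affineGrading R) = -(x ᵍ⊗ₜ[R] y) := by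
  rw [tmul_mul_tmul_of_mem 1 1 hy hx, one_mul x, mul_one y, mul_one, pow_one, neg_one_smul]

theorem isExterior_left : IsExterior
    (fun i => (G₀.gen R i ᵍ⊗ₜ[R] 1 : G₀.affineGrading R ᵍ⊗[R] G₁.affineGrading R)) :=
  isExterior_gen.map (GradedTensorProduct.includeLeft (G₀.affineGrading R) (G₁.affineGrading R))

theorem isExterior_right : IsExterior
    (fun j => (1 ᵍ⊗ₜ[R] G₁.gen R j : G₀.affineGrading R ᵍ⊗[R] G₁.affineGrading R)) :=
  isExterior_gen.map (GradedTensorProduct.includeRight (G₀.affineGrading R) (G₁.affineGrading R))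

open Classical in
variable (R f₀ f₁) in
/-- The element of the tensor product that corresponds to a point of a union. -/
def unionGen (k : P.Pt) : G₀.affineGrading R ᵍ⊗[R] G₁.affineGrading R :=
  if h : k ∈ Set.range f₀ then G₀.gen R h.choose ᵍ⊗ₜ[R] 1
  else if h : k ∈ Set.range f₁ then 1 ᵍ⊗ₜ[R] G₁.gen R h.choose else 0

theorem IsUnion.unionGen_left (h : G₀.IsUnion G₁ P f₀ f₁) (i : G₀.Pt) :
    unionGen R f₀ f₁ (f₀ i) = G₀.gen R i ᵍ⊗ₜ[R] 1 := by
  have hi : f₀ i ∈ Set.range f₀ := ⟨i, rfl⟩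
  rw [unionGen, dif_pos hi, h.left.injective hi.choose_spec]

theorem IsUnion.unionGen_base (h : G₀.IsUnion G₁ P f₀ f₁) :
    unionGen R f₀ f₁ P.basePt = 0 := by
  rw [← h.left.map_base, h.unionGen_left, gen_base, zero_gradedTmul]

/-- The preference for the left side in `unionGen` is harmless: the sides share only the base point,
where both generators vanish. -/
theorem IsUnion.unionGen_right (h : G₀.IsUnion G₁ P f₀ f₁) (j : G₁.Pt) :
    unionGen R f₀ f₁ (f₁ j) = 1 ᵍ⊗ₜ[R] G₁.gen R j := by
  have hj : f₁ j ∈ Set.range f₁ := ⟨j, rfl⟩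
  by_cases hj' : f₁ j ∈ Set.range f₀
  · have hb : f₁ j = P.basePt := by
      have : f₁ j ∈ Set.range f₀ ∩ Set.range f₁ := ⟨hj', hj⟩
      rwa [h.inter_eq] at this
    have hjb : j = G₁.basePt := h.right.injective (hb.trans h.right.map_base.symm)
    rw [hb, h.unionGen_base, hjb, gen_base, gradedTmul_zero]
  · rw [unionGen, dif_neg hj', dif_pos hj, h.right.injective hj.choose_spec]

theorem IsUnion.cases (h : G₀.IsUnion G₁ P f₀ f₁) (k : P.Pt) :
    (∃ i, f₀ i = k) ∨ ∃ j, f₁ j = k :=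
  h.union_eq.ge (Set.mem_univ k)

theorem IsUnion.isExterior_unionGen (h : G₀.IsUnion G₁ P f₀ f₁) :
    IsExterior (unionGen R f₀ f₁) := by
  constructor
  · intro k
    rcases h.cases k with ⟨i, rfl⟩ | ⟨i, rfl⟩
    · rw [h.unionGen_left]; exact isExterior_left.mul_self i
    · rw [h.unionGen_right]; exact isExterior_right.mul_self i
  · intro k l
    rcases h.cases k with ⟨i, rfl⟩ | ⟨i, rfl⟩ <;> rcases h.cases l with ⟨j, rfl⟩ | ⟨j, rfl⟩
    · rw [h.unionGen_left, h.unionGen_left]; exact isExterior_left.anticomm i j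
    · rw [h.unionGen_left, h.unionGen_right, left_mul_right,
        right_mul_left (gen_mem i) (gen_mem j), add_neg_cancel]
    · rw [h.unionGen_left, h.unionGen_right, left_mul_right,
        right_mul_left (gen_mem j) (gen_mem i), neg_add_cancel]
    · rw [h.unionGen_right, h.unionGen_right]; exact isExterior_right.anticomm i j

/-- On tuples from one side the lift factors through the Orlik–Solomon algebra of G, by way of
`retract`, and there the relation already holds. -/
theorem IsEmbedding.extLift_boundary_eq_zero {G : PointedMatroid α} {A : Type*} [Ring A]
    [Algebra R A] {f : G.Pt → P.Pt} (hf : G.IsEmbedding P f) (g : P.Pt → A) (hg : IsExterior g)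
    (φ : G.affineOS R →ₐ[R] A) (hφ : ∀ i, φ (G.gen R i) = g (f i)) {S : List P.Pt}
    (hSf : ∀ k ∈ S, k ∈ Set.range f) (hS : IsDependent P.matroid S) :
    extLift R g hg (boundary R P.Pt (eProd R S)) = 0 := by
  obtain ⟨S, rfl⟩ : S ∈ Set.range (List.map f) := by rwa [Set.range_list_map]
  rw [(extLift_comp_map g hg f S).2]
  have h1 := mk_boundary (R := R) ((hf.isDependent_map S).mp hS)
  have h2 : extLift R (g ∘ f) (hg.comp f) = (φ.comp (retract R G)).comp (OrlikSolomon.mk R G.matroid) :=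
    ext_algHom fun i => by
      rw [extLift_e]
      exact ((congrArg φ (retract_a i)).trans (hφ i)).symm
  rw [h2]
  change φ (retract R G (OrlikSolomon.mk R G.matroid _)) = 0
  rw [h1, map_zero, map_zero]

/-- The entries of a tuple that lie in the range of an injection. -/
theorem setOf_mem_filter {G : PointedMatroid α} (f : G.Pt → P.Pt)
    [DecidablePred (· ∈ Set.range f)] (S : List P.Pt) :
    {x : γ | ∃ k ∈ S.filter (fun k => decide (k ∈ Set.range f)), (k : γ) = x}
      = {x | ∃ k ∈ S, (k : γ) = x} ∩ Set.range (fun i => (f i : γ)) := by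
  ext x
  constructor
  · rintro ⟨k, hk, rfl⟩
    obtain ⟨hk, hi⟩ := List.mem_filter.mp hk
    obtain ⟨i, rfl⟩ := of_decide_eq_true hi
    exact ⟨⟨_, hk, rfl⟩, i, rfl⟩
  · rintro ⟨⟨k, hk, rfl⟩, i, hi⟩
    exact ⟨k, List.mem_filter.mpr ⟨hk, decide_eq_true ⟨i, Subtype.ext hi⟩⟩, rfl⟩

theorem setOf_mem_cons (k : P.Pt) (S : List P.Pt) :
    {x : γ | ∃ l ∈ k :: S, (l : γ) = x} = insert (k : γ) {x | ∃ l ∈ S, (l : γ) = x} := by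
  ext x
  simp [eq_comm]

/-- A homomorphism that kills the base point and the relations of both sides kills the relations of
the parallel connection. -/
theorem IsParallelConnection.kills [G₀.matroid.Finite] [G₁.matroid.Finite]
    (hP : G₀.IsParallelConnection G₁ P f₀ f₁) (h₀ : G₀.matroid.IsNonloop G₀.base)
    {A : Type*} [Ring A] [Algebra R A] (φ : Ext R P.Pt →ₐ[R] A)
    (hbase : φ (e R P.basePt) = 0)
    (hker₀ : ∀ S : List P.Pt, (∀ k ∈ S, k ∈ Set.range f₀) → IsDependent P.matroid S →
      φ (boundary R P.Pt (eProd R S)) = 0)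
    (hker₁ : ∀ S : List P.Pt, (∀ k ∈ S, k ∈ Set.range f₁) → IsDependent P.matroid S →
      φ (boundary R P.Pt (eProd R S)) = 0)
    {S : List P.Pt} (hS : IsDependent P.matroid S) : Kills φ S := by
  classical
  have hU := hP.isUnion
  have hne : ∀ S : List P.Pt, IsDependent P.matroid S → S ≠ [] := by
    rintro _ h rfl
    exact h.nonempty.ne_empty (by simp)
  have hb₀ : P.basePt ∈ Set.range f₀ := ⟨_, hU.left.map_base⟩
  have hb₁ : P.basePt ∈ Set.range f₁ := ⟨_, hU.right.map_base⟩
  have hmem : ∀ {q : P.Pt → Prop} [DecidablePred q], ∀ k ∈ S.filter (fun k => decide (q k)), q k :=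
    fun k hk => of_decide_eq_true (List.mem_filter.mp hk).2
  have hsplit₀ : IsDependent P.matroid (S.filter (fun k => decide (k ∈ Set.range f₀))) →
      Kills φ S := fun h => (kills_of_boundary (hne _ h) (hker₀ _ hmem h)).of_filter
  have hsplit₁ : IsDependent P.matroid (S.filter (fun k => decide (k ∈ Set.range f₁))) →
      Kills φ S := fun h => (kills_of_boundary (hne _ h) (hker₁ _ hmem h)).of_filter
  rcases hP.dep h₀ hS with h | h | ⟨h, h'⟩
  · rw [← setOf_mem_filter f₀ S] at h
    exact hsplit₀ h
  · rw [← setOf_mem_filter f₁ S] at h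
    exact hsplit₁ h
  rw [← setOf_mem_filter f₀ S] at h
  rw [← setOf_mem_filter f₁ S] at h'
  -- If the base point already occurs in S, adding it to the left part changes nothing, so that part
  -- is itself dependent.
  by_cases hbS : P.basePt ∈ S
  · refine hsplit₀ ?_
    have hmemb : P.base ∈
        {x : γ | ∃ k ∈ S.filter (fun k => decide (k ∈ Set.range f₀)), (k : γ) = x} :=
      ⟨P.basePt, List.mem_filter.mpr ⟨hbS, decide_eq_true hb₀⟩, rfl⟩
    rwa [Set.insert_eq_of_mem hmemb] at h
  -- Prepending the base point gives a dependent tuple; as φ kills e_0, its relation says that the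
  -- product over the left part itself is killed.
  have hk₀ : φ (eProd R (S.filter (fun k => decide (k ∈ Set.range f₀)))) = 0 :=
    eProd_killed_of_cons hbase (hker₀ _ (List.forall_mem_cons.mpr ⟨hb₀, hmem⟩)
      (by rw [IsDependent, setOf_mem_cons]; exact h))
  have hk₁ : φ (eProd R (S.filter (fun k => decide (k ∈ Set.range f₁)))) = 0 :=
    eProd_killed_of_cons hbase (hker₁ _ (List.forall_mem_cons.mpr ⟨hb₁, hmem⟩)
      (by rw [IsDependent, setOf_mem_cons]; exact h'))
  -- The sides overlap only in the base point, which is not in S, so the entries off the left side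
  -- are exactly those on the right.
  have hcompl : S.filter (fun k => !decide (k ∈ Set.range f₀))
      = S.filter (fun k => decide (k ∈ Set.range f₁)) := by
    refine List.filter_congr fun k hk => ?_
    rw [← decide_not, decide_eq_decide]
    constructor
    · exact fun hk₀ => (hU.union_eq.ge (Set.mem_univ k)).resolve_left hk₀
    · intro hk₁ hk₀
      have : k ∈ Set.range f₀ ∩ Set.range f₁ := ⟨hk₀, hk₁⟩
      rw [hU.inter_eq] at this
      exact hbS (this ▸ hk)
  refine Kills.perm (kills_append_of_eProd hk₀ ?_)
    (List.filter_append_perm (fun k => decide (k ∈ Set.range f₀)) S)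
  rw [hcompl, hk₁]

/-- The homomorphism from the tensor product to the affine Orlik-Solomon algebra of a union. -/
def IsUnion.fromTensor (h : G₀.IsUnion G₁ P f₀ f₁) :
    (G₀.affineGrading R ᵍ⊗[R] G₁.affineGrading R) →ₐ[R] P.affineOS R :=
  GradedTensorProduct.lift (G₀.affineGrading R) (G₁.affineGrading R) h.left.affineMap
    h.right.affineMap fun i j x y => by
      rw [mul_of_mem_affineGrading (h.left.affineMap_mem x.2) (h.right.affineMap_mem y.2)]
      rcases Nat.even_or_odd (j * i) with h | h <;> simp [h.neg_one_pow]

theorem IsUnion.fromTensor_tmul (h : G₀.IsUnion G₁ P f₀ f₁) (x : G₀.affineOS R)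
    (y : G₁.affineOS R) :
    h.fromTensor (x ᵍ⊗ₜ[R] y) = h.left.affineMap x * h.right.affineMap y :=
  GradedTensorProduct.lift_tmul _ _ _ _ _ x y

theorem IsUnion.fromTensor_left (h : G₀.IsUnion G₁ P f₀ f₁) (i : G₀.Pt) :
    h.fromTensor (G₀.gen R i ᵍ⊗ₜ[R] 1) = P.gen R (f₀ i) := by
  rw [h.fromTensor_tmul, map_one, mul_one, h.left.affineMap_gen]

theorem IsUnion.fromTensor_right (h : G₀.IsUnion G₁ P f₀ f₁) (j : G₁.Pt) :
    h.fromTensor (1 ᵍ⊗ₜ[R] G₁.gen R j) = P.gen R (f₁ j) := by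
  rw [h.fromTensor_tmul, map_one, one_mul, h.right.affineMap_gen]

theorem IsUnion.fromTensor_unionGen (h : G₀.IsUnion G₁ P f₀ f₁) (k : P.Pt) :
    h.fromTensor (unionGen R f₀ f₁ k) = P.gen R k := by
  rcases h.cases k with ⟨i, rfl⟩ | ⟨j, rfl⟩
  · rw [h.unionGen_left, h.fromTensor_left]
  · rw [h.unionGen_right, h.fromTensor_right]

theorem IsUnion.unionGen_mem (h : G₀.IsUnion G₁ P f₀ f₁) (k : P.Pt) :
    unionGen R f₀ f₁ k ∈ tensorGrading (G₀.affineGrading R) (G₁.affineGrading R) 1 := by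
  rcases h.cases k with ⟨i, rfl⟩ | ⟨j, rfl⟩
  · rw [h.unionGen_left]
    exact tmul_one_mem_tensorGrading (gen_mem i)
  · rw [h.unionGen_right]
    exact one_tmul_mem_tensorGrading (gen_mem j)

theorem IsUnion.fromTensor_mem (h : G₀.IsUnion G₁ P f₀ f₁) {n : ℕ}
    {t : G₀.affineGrading R ᵍ⊗[R] G₁.affineGrading R}
    (ht : t ∈ tensorGrading (G₀.affineGrading R) (G₁.affineGrading R) n) :
    h.fromTensor (R := R) t ∈ P.affineGrading R n := by
  exact map_mem_of_mem_tensorGrading (P.affineGrading R) h.fromTensor h.fromTensor_tmul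
    (fun _ _ hx => h.left.affineMap_mem hx) (fun _ _ hy => h.right.affineMap_mem hy) ht

section toTensor

variable [G₀.matroid.Finite] [G₁.matroid.Finite]

/-- The homomorphism from the Orlik-Solomon algebra of a parallel connection to the tensor
product. -/
def IsParallelConnection.toTensor (hP : G₀.IsParallelConnection G₁ P f₀ f₁)
    (h₀ : G₀.matroid.IsNonloop G₀.base) :
    OS R P.matroid →ₐ[R] (G₀.affineGrading R ᵍ⊗[R] G₁.affineGrading R) :=
  osLift (extLift R (unionGen R f₀ f₁) hP.isUnion.isExterior_unionGen) fun S hS =>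
    (hP.kills h₀ _ (by rw [extLift_e, hP.isUnion.unionGen_base])
      (fun _ => hP.isUnion.left.extLift_boundary_eq_zero _ _
        (GradedTensorProduct.includeLeft (G₀.affineGrading R) (G₁.affineGrading R))
        fun i => (hP.isUnion.unionGen_left i).symm)
      (fun _ => hP.isUnion.right.extLift_boundary_eq_zero _ _
        (GradedTensorProduct.includeRight (G₀.affineGrading R) (G₁.affineGrading R))
        fun i => (hP.isUnion.unionGen_right i).symm) hS).boundary

variable (hP : G₀.IsParallelConnection G₁ P f₀ f₁) (h₀ : G₀.matroid.IsNonloop G₀.base)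

theorem IsParallelConnection.toTensor_a (k : P.Pt) :
    hP.toTensor h₀ (a R P.matroid k) = unionGen R f₀ f₁ k := by
  rw [toTensor, osLift_a, extLift_e]

theorem IsParallelConnection.toTensor_gen (k : P.Pt) :
    hP.toTensor h₀ (P.gen R k : OS R P.matroid) = unionGen R f₀ f₁ k := by
  change hP.toTensor h₀ (a R P.matroid k - a R P.matroid P.basePt) = _
  rw [map_sub, toTensor_a, toTensor_a, hP.isUnion.unionGen_base, sub_zero]

theorem IsParallelConnection.fromTensor_comp_toTensor :
    (hP.isUnion.fromTensor (R := R)).comp ((hP.toTensor (R := R) h₀).comp (P.affineOS R).val)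
      = AlgHom.id R (P.affineOS R) :=
  affineOS_algHom_ext fun k =>
    (congrArg (hP.isUnion.fromTensor (R := R)) (hP.toTensor_gen h₀ k)).trans
      (hP.isUnion.fromTensor_unionGen k)

/-- A homomorphism from the tensor product is determined on the two factors, hence on their
generators. -/
theorem IsParallelConnection.toTensor_comp_fromTensor :
    ((hP.toTensor (R := R) h₀).comp (P.affineOS R).val).comp (hP.isUnion.fromTensor (R := R))
      = AlgHom.id R (G₀.affineGrading R ᵍ⊗[R] G₁.affineGrading R) := by
  refine GradedTensorProduct.algHom_ext _ _ (affineOS_algHom_ext fun i => ?_)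
    (affineOS_algHom_ext fun j => ?_)
  · have h := congrArg (fun z : P.affineOS R => hP.toTensor h₀ (z : OS R P.matroid))
      (hP.isUnion.fromTensor_left (R := R) i)
    exact h.trans ((hP.toTensor_gen h₀ _).trans (hP.isUnion.unionGen_left i))
  · have h := congrArg (fun z : P.affineOS R => hP.toTensor h₀ (z : OS R P.matroid))
      (hP.isUnion.fromTensor_right (R := R) j)
    exact h.trans ((hP.toTensor_gen h₀ _).trans (hP.isUnion.unionGen_right j))

/-- The affine Orlik-Solomon algebra of a parallel connection is a tensor product. -/
def IsParallelConnection.tensorEquiv :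
    (G₀.affineGrading R ᵍ⊗[R] G₁.affineGrading R) ≃ₐ[R] P.affineOS R :=
  AlgEquiv.ofAlgHom hP.isUnion.fromTensor ((hP.toTensor h₀).comp (P.affineOS R).val)
    (hP.fromTensor_comp_toTensor h₀) (hP.toTensor_comp_fromTensor h₀)

/-- Both the isomorphism and its inverse preserve degree; the inverse gives surjectivity onto each
component. -/
theorem IsParallelConnection.map_tensorGrading (n : ℕ) :
    (tensorGrading (G₀.affineGrading R) (G₁.affineGrading R) n).map
      (hP.tensorEquiv (R := R) h₀).toLinearMap = P.affineGrading R n := by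
  refine le_antisymm (Submodule.map_le_iff_le_comap.mpr fun t ht => hP.isUnion.fromTensor_mem ht)
    fun z hz => ⟨(hP.tensorEquiv h₀).symm z, ?_, (hP.tensorEquiv h₀).apply_symm_apply z⟩
  exact map_mem_of_mem_grading (tensorGrading (G₀.affineGrading R) (G₁.affineGrading R))
    (hP.toTensor h₀) (fun k => by rw [toTensor_a]; exact hP.isUnion.unionGen_mem k) hz

end toTensor

end PointedMatroid

end

theorem theorem3p8 {R : Type*} [CommRing R] {α β γ : Type*}
    (G₀ : PointedMatroid α) (G₁ : PointedMatroid β) [G₀.matroid.Finite] [G₁.matroid.Finite]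
    (h₀ : G₀.matroid.IsNonloop G₀.base) (h₁ : G₁.matroid.IsNonloop G₁.base)
    (P : PointedMatroid γ) (f₀ : G₀.Pt → P.Pt) (f₁ : G₁.Pt → P.Pt)
    (hP : G₀.IsParallelConnection G₁ P f₀ f₁) :
    ∃ Φ : (G₀.affineGrading R ᵍ⊗[R] G₁.affineGrading R) ≃ₐ[R] P.affineOS R,
      (∀ n : ℕ, (tensorGrading (G₀.affineGrading R) (G₁.affineGrading R) n).map Φ.toLinearMap
        = P.affineGrading R n) ∧
      (∀ i : G₀.Pt, Φ (G₀.gen R i ᵍ⊗ₜ[R] 1) = P.gen R (f₀ i)) ∧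
      (∀ j : G₁.Pt, Φ (1 ᵍ⊗ₜ[R] G₁.gen R j) = P.gen R (f₁ j)) :=
  ⟨hP.tensorEquiv h₀, hP.map_tensorGrading h₀, hP.isUnion.fromTensor_left,
    hP.isUnion.fromTensor_right⟩
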